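/- Let $n\ge 1$. Let $\mathcal T_n$ be the class of nonpositive functions $\psi\in C^\infty((-\infty,0)^n)$ all of whose first-order partial derivatives are absolutely monotone, i.e. nonnegative together with all their partial derivatives of all orders. Let $\psi\in\mathcal T_n$ be not identically zero. Then $\psi$ has an integral representation $$\psi(s)=c_0+c_1\cdot s+\int_{\mathbb R_+^n\setminus\{0\}}\left(e^{s\cdot u}-1\right)d\mu(u),\qquad s\in(-\infty,0)^n,$$ where $c_0\le 0$, $c_1\in\mathbb R_+^n$, and $\mu$ is a positive measure on $\mathbb R_+^n\setminus\{0\}$ such that, for all sufficiently small $\delta>0$, the functions $u\mapsto u_j$ are $\mu$-integrable on $[0,\delta)^n\setminus\{0\}$ for $j=1,\dots,n$ and $\mu(\mathbb R_+^n\setminus[0,\delta)^n)<\infty$. For any such representation, the formula $$\psi(z)=c_0+c_1\cdot z+\int_{\mathbb R_+^n\setminus\{0\}}\left(e^{z\cdot u}-1\right)d\mu(u)$$ (whose integral converges absolutely whenever $z$ is in the closure of $\{\mathrm{Re}\,z<0\}:=\{z\in\mathbb C^n:\mathrm{Re}\,z_j<0,\ j=1,\dots,n\}$) extends $\psi$ to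 a function holomorphic in the domain $\{\mathrm{Re}\,z<0\}$ and continuous on its closure, and this extended function $\psi$ maps the domain $\{\mathrm{Re}\,z<0\}$ into the open half-plane $\{\zeta\in\mathbb C:\mathrm{Re}\,\zeta<0\}$ and, for every $\theta\in[0,\pi]$, maps the cone $S_\theta^n$ into the sector $S_\theta$. Here $S_\theta$ is the closed sector consisting of $0$ and all $\zeta\ne 0$ that have an argument in $[\frac{\pi}{2}+\frac{\theta}{2},\frac{3\pi}{2}-\frac{\theta}{2}]$; for $\theta<\pi$ it is the closure of the corresponding open sector, and $S_\pi=(-\infty,0]$. -/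

import Mathlib

open Set Filter Topology MeasureTheory
open scoped ContDiff

noncomputable section

/-- The open negative orthant `(-∞, 0)ⁿ`. -/
def negOrthant (n : ℕ) : Set (Fin n → ℝ) := {s | ∀ j, s j < 0}

/-- The partial derivative of `f` with respect to the `i`-th coordinate. -/
def partialDeriv {n : ℕ} (i : Fin n) (f : (Fin n → ℝ) → ℝ) : (Fin n → ℝ) → ℝ :=
  fun s => fderiv ℝ f s (Pi.single i 1)

/-- The iterated partial derivative of `f` along a finite list of coordinate directions. -/
def iteratedPartialDeriv {n : ℕ} : List (Fin n) → ((Fin n → ℝ) → ℝ) → ((Fin n → ℝ) → ℝ)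
  | [], f => f
  | i :: L, f => partialDeriv i (iteratedPartialDeriv L f)

/-- `f` is absolutely monotone on `(-∞, 0)ⁿ`: it is smooth there and is nonnegative together with
all its partial derivatives of all orders. -/
def IsAbsMonotone {n : ℕ} (f : (Fin n → ℝ) → ℝ) : Prop :=
  ContDiffOn ℝ ∞ f (negOrthant n) ∧
    ∀ L : List (Fin n), ∀ s ∈ negOrthant n, 0 ≤ iteratedPartialDeriv L f s

/-- The class `𝒯ₙ` of negative Bernstein functions of `n` variables: nonpositive smooth functions
on `(-∞, 0)ⁿ` all of whose first order partial derivatives are absolutely monotone. Only the values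
of `ψ` on `(-∞, 0)ⁿ` matter. -/
structure IsNegBernstein {n : ℕ} (ψ : (Fin n → ℝ) → ℝ) : Prop where
  contDiffOn : ContDiffOn ℝ ∞ ψ (negOrthant n)
  nonpos : ∀ s ∈ negOrthant n, ψ s ≤ 0
  partialDeriv_absMonotone : ∀ i : Fin n, IsAbsMonotone (partialDeriv i ψ)

/-- The punctured closed orthant `ℝ₊ⁿ \ {0}`. -/
def puncturedOrthant (n : ℕ) : Set (Fin n → ℝ) := {u | (∀ j, 0 ≤ u j) ∧ u ≠ 0}

/-- The half-open cube `[0, δ)ⁿ`. -/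
def cube (n : ℕ) (δ : ℝ) : Set (Fin n → ℝ) := {u | ∀ j, 0 ≤ u j ∧ u j < δ}

/-- The integrand `e^{z · u} - 1`, for `z ∈ ℂⁿ` and `u ∈ ℝⁿ`. -/
def bernsteinKernel {n : ℕ} (z : Fin n → ℂ) (u : Fin n → ℝ) : ℂ :=
  Complex.exp (∑ j, z j * (u j : ℂ)) - 1

/-- The function `z ↦ c₀ + c₁ · z + ∫_{ℝ₊ⁿ \ {0}} (e^{z · u} - 1) dμ(u)` on `ℂⁿ`. -/
def bernsteinExt {n : ℕ} (c₀ : ℝ) (c₁ : Fin n → ℝ) (μ : Measure (Fin n → ℝ))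
    (z : Fin n → ℂ) : ℂ :=
  (c₀ : ℂ) + ∑ j, (c₁ j : ℂ) * z j + ∫ u in puncturedOrthant n, bernsteinKernel z u ∂μ

/-- `(c₀, c₁, μ)` are the data of an integral representation
`ψ(s) = c₀ + c₁ · s + ∫_{ℝ₊ⁿ \ {0}} (e^{s · u} - 1) dμ(u)` on `(-∞, 0)ⁿ`, where `c₀ ≤ 0`,
`c₁ ∈ ℝ₊ⁿ`, and `μ` is a positive measure on `ℝ₊ⁿ \ {0}` such that for all small `δ > 0` the
coordinates are integrable on `[0, δ)ⁿ \ {0}` and the complement of `[0, δ)ⁿ` has finite measure.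
Only the restriction of `μ` to `ℝ₊ⁿ \ {0}` matters; by the last two conditions that restriction is
a Radon measure on `ℝ₊ⁿ \ {0}`. -/
structure IsBernsteinRep {n : ℕ} (ψ : (Fin n → ℝ) → ℝ)
    (c₀ : ℝ) (c₁ : Fin n → ℝ) (μ : Measure (Fin n → ℝ)) : Prop where
  const_nonpos : c₀ ≤ 0
  coeff_nonneg : ∀ j, 0 ≤ c₁ j
  integrableOn_coord : ∀ᶠ δ : ℝ in 𝓝[>] 0, ∀ j : Fin n,
    IntegrableOn (fun u => u j) (puncturedOrthant n ∩ cube n δ) μ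
  measure_compl_lt_top : ∀ᶠ δ : ℝ in 𝓝[>] 0, μ (puncturedOrthant n \ cube n δ) < ⊤
  eq_integral : ∀ s ∈ negOrthant n,
    ψ s = c₀ + ∑ j, c₁ j * s j
      + ∫ u in puncturedOrthant n, (Real.exp (∑ j, s j * u j) - 1) ∂μ

/-- The domain `{Re z < 0} ⊆ ℂⁿ`. -/
def leftDomain (n : ℕ) : Set (Fin n → ℂ) := {z | ∀ j, (z j).re < 0}

/-- The closed sector `S_θ`: the origin together with all complex numbers that have an argument in
`[π/2 + θ/2, 3π/2 - θ/2]`. For `θ = π` it is the ray `(-∞, 0]`; for `0 ≤ θ < π` it is the closure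
of the open sector, see `closedSector_eq_closure`. -/
def closedSector (θ : ℝ) : Set ℂ :=
  {ζ | ∃ r : ℝ, 0 ≤ r ∧ ∃ φ ∈ Icc (Real.pi / 2 + θ / 2) (3 * Real.pi / 2 - θ / 2),
    ζ = (r : ℂ) * Complex.exp ((φ : ℂ) * Complex.I)}

/-- The open sector of nonzero complex numbers with an argument in `(π/2 + θ/2, 3π/2 - θ/2)`. -/
def openSector (θ : ℝ) : Set ℂ :=
  {ζ | ∃ r : ℝ, 0 < r ∧ ∃ φ ∈ Ioo (Real.pi / 2 + θ / 2) (3 * Real.pi / 2 - θ / 2),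
    ζ = (r : ℂ) * Complex.exp ((φ : ℂ) * Complex.I)}

theorem isClosed_closedSector (θ : ℝ) : IsClosed (closedSector θ) := by
  have hset : closedSector θ = Prod.snd ''
      {p : Icc (Real.pi / 2 + θ / 2) (3 * Real.pi / 2 - θ / 2) × ℂ |
        p.2 = ((‖p.2‖ : ℝ) : ℂ) * Complex.exp (((p.1 : ℝ) : ℂ) * Complex.I)} := by
    ext ζ
    constructor
    · rintro ⟨r, hr, φ, hφ, rfl⟩
      refine ⟨(⟨φ, hφ⟩, _), ?_, rfl⟩
      simp [Complex.norm_exp_ofReal_mul_I, abs_of_nonneg hr]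
    · rintro ⟨⟨φ, ζ'⟩, h, rfl⟩
      exact ⟨‖ζ'‖, norm_nonneg _, φ, φ.2, h⟩
  rw [hset]
  apply isClosedMap_snd_of_compactSpace
  exact isClosed_eq (by fun_prop) (by fun_prop)

/-- For `θ < π` the closed sector is the closure of the open one. -/
theorem closedSector_eq_closure {θ : ℝ} (hθ : θ < Real.pi) :
    closedSector θ = closure (openSector θ) := by
  apply Subset.antisymm
  · rintro ζ ⟨r, hr, φ, hφ, rfl⟩
    have hne : Real.pi / 2 + θ / 2 ≠ 3 * Real.pi / 2 - θ / 2 := by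
      intro h; linarith
    let g : ℝ × ℝ → ℂ := fun p => (p.1 : ℂ) * Complex.exp ((p.2 : ℂ) * Complex.I)
    have hg : Continuous g := by fun_prop
    have hmem : ((r, φ) : ℝ × ℝ) ∈ closure
        (Ioi (0 : ℝ) ×ˢ Ioo (Real.pi / 2 + θ / 2) (3 * Real.pi / 2 - θ / 2)) := by
      rw [closure_prod_eq, closure_Ioi, closure_Ioo hne]
      exact ⟨hr, hφ⟩
    have h := image_closure_subset_closure_image hg ⟨_, hmem, rfl⟩
    refine closure_mono ?_ h
    rintro _ ⟨⟨a, b⟩, ⟨ha, hb⟩, rfl⟩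
    exact ⟨a, ha, b, hb, rfl⟩
  · refine closure_minimal ?_ (isClosed_closedSector θ)
    rintro ζ ⟨r, hr, φ, hφ, rfl⟩
    exact ⟨r, hr.le, φ, Ioo_subset_Icc_self hφ, rfl⟩

end

open scoped NNReal ENNReal unitInterval

/-! Put `s = -t`, which turns nonnegative partial derivatives into nonnegative iterated differences.
Normalized functions with nonnegative iterated differences form a compact convex set for pointwise
convergence. An extreme point `g` is multiplicative, because `g` is a convex combination of
multiples of `g(· + h)` and `g - g(· + h)` (`multiplicative_of_mem_extremePoints`), and
multiplicative functions are exponentials. Krein–Milman then yields Bernstein's theorem for bounded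
functions, and uniqueness of Laplace transforms removes the boundedness
(`exists_measure_lintegral_laplaceKernel`).

The function `F(t) = ψ(-t)` itself is not completely monotone, but each `F - F(· + h)` is, with a
representing measure `ν h`. By uniqueness `(1 - e^{-k·u}) ν h = (1 - e^{-h·u}) ν k`, so off the
origin `ν h = (1 - e^{-h·u}) μ` for a single `μ`. The atom of `ν h` at the origin is additive in `h`
and gives the linear term. Letting `t → 0` in `F(t) - F(t + h)` gives the representation, with `c₀ =
F(0+)` (`exists_levyKhinchin`).

The analytic claims rest on one bound: for `Re z ≤ 0` the kernel is at most a constant times `min 1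
(∑ u j)`, which is integrable (`norm_bernsteinKernel_le`). It gives convergence, continuity and,
with a similar bound on the derivative, holomorphy. A sector `S_θ` is an intersection of half-planes
and is mapped into itself by `w ↦ e^w - 1`; integration against a positive measure preserves
half-planes through `0`. The open half-plane comes from `Re ψ(z) ≤ ψ(Re z) < 0`. -/

/-! ### Cauchy functional equations. -/

/-- A nonnegative additive function on the half-line is linear. -/
theorem additive_nonneg_eq_mul {a : ℝ≥0 → ℝ} (hadd : ∀ s t, a (s + t) = a s + a t)
    (hnn : ∀ t, 0 ≤ a t) (t : ℝ≥0) : a t = t * a 1 := by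
  have hmono : ∀ s t, s ≤ t → a s ≤ a t := by
    intro s t hst
    obtain ⟨r, rfl⟩ := exists_add_of_le hst
    rw [hadd]; linarith [hnn r]
  have h0 : a 0 = 0 := by have := hadd 0 0; simp at this; exact this
  have hmul : ∀ (m : ℕ) s, a (m * s) = m * a s := by
    intro m s
    induction m with
    | zero => simp [h0]
    | succ k ih => push_cast; rw [add_mul, one_mul, hadd, ih]; ring
  have hnat : ∀ m : ℕ, a m = m * a 1 := by intro m; simpa using hmul m 1
  -- With `N = ⌊m t⌋`, both `a (m t)` and `m t * a 1` lie between `N * a 1` and `(N + 1) * a 1`. The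
  -- bound is uniform in `m`, so the Archimedean property concludes.
  have key : ∀ m : ℕ, m * |a t - t * a 1| ≤ a 1 := by
    intro m
    have h1 : a (⌊(m : ℝ≥0) * t⌋₊ : ℝ≥0) ≤ a (m * t) := hmono _ _ (Nat.floor_le (zero_le))
    have h2 : a (m * t) ≤ a ((⌊(m : ℝ≥0) * t⌋₊ + 1 : ℕ) : ℝ≥0) :=
      hmono _ _ (by push_cast; exact (Nat.lt_floor_add_one _).le)
    have h3 : ((⌊(m : ℝ≥0) * t⌋₊ : ℝ≥0) : ℝ) ≤ ((m * t : ℝ≥0) : ℝ) :=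
      NNReal.coe_le_coe.2 (Nat.floor_le (zero_le))
    have h4 : ((m * t : ℝ≥0) : ℝ) ≤ ((⌊(m : ℝ≥0) * t⌋₊ : ℝ≥0) : ℝ) + 1 := by
      have := (Nat.lt_floor_add_one ((m : ℝ≥0) * t)).le
      exact_mod_cast this
    rw [hnat, hmul] at h1 h2
    push_cast at h1 h2 h3 h4
    have ha := hnn 1
    rw [← abs_of_nonneg (Nat.cast_nonneg (α := ℝ) m), ← abs_mul, abs_le]
    constructor <;> nlinarith
  by_contra hne
  have hpos : 0 < |a t - t * a 1| := abs_pos.2 (sub_ne_zero.2 hne)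
  obtain ⟨m, hm⟩ := exists_nat_gt (a 1 / |a t - t * a 1|)
  rw [div_lt_iff₀ hpos] at hm
  linarith [key m]

/-- A multiplicative function from the half-line to `[0, 1]` is a power function away from `0`. -/
theorem multiplicative_eq_rpow {φ : ℝ≥0 → ℝ} (h0 : φ 0 = 1)
    (hmul : ∀ s t, φ (s + t) = φ s * φ t) (hnn : ∀ t, 0 ≤ φ t) (hle : ∀ t, φ t ≤ 1)
    {t : ℝ≥0} (ht : 0 < t) : φ t = φ 1 ^ (t : ℝ) := by
  have hpow : ∀ (m : ℕ) s, φ (m * s) = φ s ^ m := by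
    intro m s
    induction m with
    | zero => simp [h0]
    | succ k ih => push_cast; rw [add_mul, one_mul, hmul, ih, pow_succ]
  have hanti : ∀ s t, s ≤ t → φ t ≤ φ s := by
    intro s t hst
    obtain ⟨r, rfl⟩ := exists_add_of_le hst
    rw [hmul]; exact mul_le_of_le_one_right (hnn s) (hle r)
  rcases (hnn 1).eq_or_lt with h1 | h1
  · rw [← h1, Real.zero_rpow (by exact_mod_cast ht.ne')]
    obtain ⟨m, hm⟩ := exists_nat_gt t⁻¹
    have hmp : 0 < (m : ℝ≥0) := lt_trans (inv_pos.2 ht) hm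
    have h2 : φ ((m : ℝ≥0)⁻¹) = 0 := by
      have := hpow m (m : ℝ≥0)⁻¹
      rw [mul_inv_cancel₀ hmp.ne', ← h1] at this
      exact eq_zero_of_pow_eq_zero this.symm
    refine le_antisymm (h2 ▸ hanti _ _ ?_) (hnn t)
    exact inv_le_of_inv_le₀ ht hm.le
  · have hpos : ∀ t, 0 < φ t := by
      intro t
      obtain ⟨m, hm⟩ := exists_nat_ge t
      have := hpow m 1
      rw [mul_one] at this
      exact lt_of_lt_of_le (this ▸ pow_pos h1 m) (hanti _ _ hm)
    have := additive_nonneg_eq_mul (a := fun t => -Real.log (φ t))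
      (fun s t => by rw [hmul, Real.log_mul (hpos s).ne' (hpos t).ne']; ring)
      (fun t => by have := Real.log_nonpos (hnn t) (hle t); linarith) t
    rw [Real.rpow_def_of_pos h1, ← Real.exp_log (hpos t)]
    congr 1
    linarith

theorem multiplicative_eq_prod_rpow {n : ℕ} {φ : (Fin n → ℝ≥0) → ℝ} (h0 : φ 0 = 1)
    (hmul : ∀ s t, φ (s + t) = φ s * φ t) (hnn : ∀ t, 0 ≤ φ t) (hle : ∀ t, φ t ≤ 1)
    {t : Fin n → ℝ≥0} (ht : ∀ j, 0 < t j) :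
    φ t = ∏ j, φ (Pi.single j 1) ^ (t j : ℝ) := by
  have hsum : ∀ (s : Finset (Fin n)) (v : Fin n → Fin n → ℝ≥0),
      φ (∑ j ∈ s, v j) = ∏ j ∈ s, φ (v j) := by
    intro s v
    induction s using Finset.induction_on with
    | empty => simp [h0]
    | insert j s hj ih => rw [Finset.sum_insert hj, Finset.prod_insert hj, hmul, ih]
  conv_lhs => rw [← Finset.univ_sum_single t]
  rw [hsum]
  refine Finset.prod_congr rfl fun j _ => ?_
  exact multiplicative_eq_rpow (φ := fun r => φ (Pi.single j r)) (by simpa using h0)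
    (fun s t => by rw [Pi.single_add, hmul]) (fun _ => hnn _) (fun _ => hle _) (ht j)

/-! ### Completely monotone functions on a monoid and their extreme points. -/

/-- Iterated differences `∏ (1 - E_h) g`, where `E_h` is the shift by `h`. -/
def iterDiff {S : Type*} [AddCommMonoid S] : List S → (S → ℝ) → S → ℝ
  | [], g => g
  | h :: H, g => iterDiff H (fun t => g t - g (t + h))

section CompletelyMonotone

variable {S : Type*} [AddCommMonoid S]

theorem iterDiff_shift (H : List S) (g : S → ℝ) (h t : S) :
    iterDiff H (fun t => g (t + h)) t = iterDiff H g (t + h) := by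
  induction H generalizing g with
  | nil => rfl
  | cons k H ih =>
    simp only [iterDiff]
    rw [← ih]
    simp only [add_right_comm _ h k]

theorem iterDiff_linear (H : List S) (a b : ℝ) (f g : S → ℝ) (t : S) :
    iterDiff H (fun t => a * f t + b * g t) t = a * iterDiff H f t + b * iterDiff H g t := by
  induction H generalizing f g with
  | nil => rfl
  | cons k H ih =>
    simp only [iterDiff]
    rw [← ih]
    congr 1
    ext t; ring

theorem iterDiff_const_mul (H : List S) (a : ℝ) (f : S → ℝ) (t : S) :
    iterDiff H (fun t => a * f t) t = a * iterDiff H f t := by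
  simpa using iterDiff_linear H a 0 f 0 t

theorem continuous_iterDiff (H : List S) (t : S) :
    Continuous fun g : S → ℝ => iterDiff H g t := by
  induction H with
  | nil => exact continuous_apply t
  | cons k H ih =>
    exact ih.comp (continuous_pi fun t => (continuous_apply t).sub (continuous_apply (t + k)))

/-- Normalized completely monotone functions on a commutative monoid. -/
def completelyMonotoneBase (S : Type*) [AddCommMonoid S] : Set (S → ℝ) :=
  {g | g 0 = 1 ∧ ∀ H t, 0 ≤ iterDiff H g t}

theorem antitone_of_iterDiff_nonneg {g : S → ℝ} (hg : ∀ H t, 0 ≤ iterDiff H g t) (t h : S) :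
    g (t + h) ≤ g t := by
  have := hg [h] t
  simp only [iterDiff] at this
  linarith

theorem nonneg_of_iterDiff_nonneg {g : S → ℝ} (hg : ∀ H t, 0 ≤ iterDiff H g t) (t : S) :
    0 ≤ g t := hg [] t

theorem le_zero_of_iterDiff_nonneg {g : S → ℝ} (hg : ∀ H t, 0 ≤ iterDiff H g t) (t : S) :
    g t ≤ g 0 := by
  simpa using antitone_of_iterDiff_nonneg hg 0 t

theorem convex_completelyMonotoneBase : Convex ℝ (completelyMonotoneBase S) := by
  rintro f ⟨hf0, hf⟩ g ⟨hg0, hg⟩ a b ha hb hab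
  refine ⟨by simp [hf0, hg0, hab], fun H t => ?_⟩
  have := iterDiff_linear H a b f g t
  change 0 ≤ iterDiff H (fun t => a * f t + b * g t) t
  rw [this]
  have := hf H t
  have := hg H t
  positivity

/-- Every value lies in `[0, 1]`, and each defining condition involves only finitely many values,
hence is closed for pointwise convergence; Tychonoff's theorem applies. -/
theorem isCompact_completelyMonotoneBase : IsCompact (completelyMonotoneBase S) := by
  refine (isCompact_univ_pi fun _ : S => isCompact_Icc (a := (0 : ℝ)) (b := 1)).of_isClosed_subset
    ?_ ?_
  · have : completelyMonotoneBase S = {g | g 0 = 1} ∩ ⋂ H, ⋂ t, {g | 0 ≤ iterDiff H g t} := by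
      ext g; simp [completelyMonotoneBase]
    rw [this]
    refine (isClosed_eq (continuous_apply 0) continuous_const).inter ?_
    exact isClosed_iInter fun H => isClosed_iInter fun t =>
      isClosed_le continuous_const (continuous_iterDiff H t)
  · rintro g ⟨h0, hg⟩ t -
    exact ⟨nonneg_of_iterDiff_nonneg hg t, h0 ▸ le_zero_of_iterDiff_nonneg hg t⟩

/-- Extreme points of the set of normalized completely monotone functions are multiplicative. -/
theorem multiplicative_of_mem_extremePoints {g : S → ℝ}
    (hg : g ∈ (completelyMonotoneBase S).extremePoints ℝ) (t h : S) : g (t + h) = g t * g h := by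
  obtain ⟨⟨h0, hcm⟩, hext⟩ := mem_extremePoints.1 hg
  have hshift : ∀ H t, 0 ≤ iterDiff H (fun t => g (t + h)) t := fun H t => by
    rw [iterDiff_shift]; exact hcm _ _
  have hdiff : ∀ H t, 0 ≤ iterDiff H (fun t => g t - g (t + h)) t := fun H t => hcm (h :: H) t
  have hc0 := nonneg_of_iterDiff_nonneg hcm h
  have hc1 : g h ≤ 1 := h0 ▸ le_zero_of_iterDiff_nonneg hcm h
  -- For `g h = 0` or `g h = 1` one of the two pieces `g(· + h)`, `g - g(· + h)` is zero at `0`,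
  -- hence identically, and cannot be normalized. Multiplicativity is then immediate.
  rcases hc0.eq_or_lt with hc | hc0
  · have h1 := le_zero_of_iterDiff_nonneg hshift t
    have h2 := nonneg_of_iterDiff_nonneg hshift t
    simp only [zero_add] at h1
    rw [← hc] at h1 ⊢
    linarith
  rcases hc1.eq_or_lt with hc | hc1
  · have h1 := le_zero_of_iterDiff_nonneg hdiff t
    have h2 := nonneg_of_iterDiff_nonneg hdiff t
    simp only [zero_add, h0, hc] at h1
    rw [hc]; linarith
  have hc1' : 0 < 1 - g h := by linarith
  have hmem1 : (fun t => (g h)⁻¹ * g (t + h)) ∈ completelyMonotoneBase S := by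
    refine ⟨by simp [hc0.ne'], fun H t => ?_⟩
    rw [iterDiff_const_mul]
    exact mul_nonneg (inv_nonneg.2 hc0.le) (hshift H t)
  have hmem2 : (fun t => (1 - g h)⁻¹ * (g t - g (t + h))) ∈ completelyMonotoneBase S := by
    refine ⟨by simp [h0, hc1'.ne'], fun H t => ?_⟩
    rw [iterDiff_const_mul]
    exact mul_nonneg (inv_nonneg.2 hc1'.le) (hdiff H t)
  have hseg : g ∈ openSegment ℝ (fun t => (g h)⁻¹ * g (t + h))
      (fun t => (1 - g h)⁻¹ * (g t - g (t + h))) := by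
    refine ⟨g h, 1 - g h, hc0, hc1', by ring, ?_⟩
    ext t
    simp only [Pi.add_apply, Pi.smul_apply, smul_eq_mul]
    field_simp
    ring
  have := congrFun (hext _ hmem1 _ hmem2 hseg).1 t
  rw [← this]
  field_simp

end CompletelyMonotone

/-! ### Bernstein's theorem for bounded functions. -/

theorem continuous_prod_rpow {n : ℕ} (t : Fin n → ℝ≥0) :
    Continuous fun x : Fin n → I => ∏ j, (x j : ℝ) ^ (t j : ℝ) :=
  continuous_finsetProd _ fun j _ =>
    (Real.continuous_rpow_const (by positivity)).comp
      (continuous_subtype_val.comp (continuous_apply j))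

/-- Every normalized completely monotone function on `ℝ₊ⁿ` is, in the interior, a mixture of
power functions with bases in `[0, 1]`. -/
theorem exists_probabilityMeasure_of_completelyMonotone {n : ℕ} {g : (Fin n → ℝ≥0) → ℝ}
    (hg : g ∈ completelyMonotoneBase (Fin n → ℝ≥0)) :
    ∃ ν : ProbabilityMeasure (Fin n → I), ∀ t : Fin n → ℝ≥0, (∀ j, 0 < t j) →
      ∫ x, ∏ j, (x j : ℝ) ^ (t j : ℝ) ∂(ν : Measure (Fin n → I)) = g t := by
  let T := {t : Fin n → ℝ≥0 // ∀ j, 0 < t j}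
  let Φ : ProbabilityMeasure (Fin n → I) → T → ℝ :=
    fun ν t => ∫ x, ∏ j, (x j : ℝ) ^ (t.1 j : ℝ) ∂(ν : Measure (Fin n → I))
  let R : ((Fin n → ℝ≥0) → ℝ) → T → ℝ := fun g t => g t.1
  have hR : Continuous R := continuous_pi fun t => continuous_apply t.1
  let F : T → BoundedContinuousFunction (Fin n → I) ℝ := fun t =>
    BoundedContinuousFunction.mkOfCompact ⟨_, continuous_prod_rpow t.1⟩
  have hint : ∀ (ν : Measure (Fin n → I)) [IsFiniteMeasure ν] (t : T),
      Integrable (fun x : Fin n → I => ∏ j, (x j : ℝ) ^ (t.1 j : ℝ)) ν :=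
    fun ν _ t => (F t).integrable ν
  have hΦ : Continuous Φ := continuous_pi fun t =>
    ProbabilityMeasure.continuous_integral_boundedContinuousFunction (F t)
  have hclosed : IsClosed (range Φ) := (isCompact_range hΦ).isClosed
  have hconv : Convex ℝ (range Φ) := by
    rintro _ ⟨ν₁, rfl⟩ _ ⟨ν₂, rfl⟩ a b ha hb hab
    have hprob : IsProbabilityMeasure (ENNReal.ofReal a • (ν₁ : Measure (Fin n → I)) +
        ENNReal.ofReal b • (ν₂ : Measure (Fin n → I))) := by
      constructor
      simp [← ENNReal.ofReal_add ha hb, hab]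
    refine ⟨⟨_, hprob⟩, ?_⟩
    ext t
    change ∫ x, _ ∂(ENNReal.ofReal a • (ν₁ : Measure (Fin n → I)) +
        ENNReal.ofReal b • (ν₂ : Measure (Fin n → I))) = _
    rw [integral_add_measure ((hint _ t).smul_measure ENNReal.ofReal_ne_top)
      ((hint _ t).smul_measure ENNReal.ofReal_ne_top), integral_smul_measure,
      integral_smul_measure, ENNReal.toReal_ofReal ha, ENNReal.toReal_ofReal hb]
    rfl
  have hlin : Convex ℝ (R ⁻¹' range Φ) := by
    intro x hx y hy a b ha hb hab
    exact hconv hx hy ha hb hab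
  -- Krein–Milman: the mixtures form a closed convex set, so it suffices to treat extreme points,
  -- which are given by Dirac masses.
  have hsub : completelyMonotoneBase (Fin n → ℝ≥0) ⊆ R ⁻¹' range Φ := by
    rw [← closure_convexHull_extremePoints isCompact_completelyMonotoneBase
      convex_completelyMonotoneBase]
    refine closure_minimal (convexHull_min ?_ hlin) (hclosed.preimage hR)
    intro φ hφ
    have hmem := hφ.1
    have hnn := nonneg_of_iterDiff_nonneg hmem.2
    have hle : ∀ t, φ t ≤ 1 := fun t => hmem.1 ▸ le_zero_of_iterDiff_nonneg hmem.2 t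
    refine ⟨⟨Measure.dirac fun j => ⟨φ (Pi.single j 1), hnn _, hle _⟩, inferInstance⟩, ?_⟩
    ext t
    change ∫ x, _ ∂(Measure.dirac _) = _
    rw [integral_dirac]
    exact (multiplicative_eq_prod_rpow hmem.1 (multiplicative_of_mem_extremePoints hφ) hnn hle
      t.2).symm
  obtain ⟨ν, hν⟩ := hsub hg
  exact ⟨ν, fun t ht => congrFun hν ⟨t, ht⟩⟩

/-- The Laplace kernel `e^{-t · u}` on `ℝ₊ⁿ × ℝ₊ⁿ`, with values in `[0, ∞]`. -/
noncomputable def laplaceKernel {n : ℕ} (t u : Fin n → ℝ≥0) : ℝ≥0∞ :=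
  ENNReal.ofReal (Real.exp (-∑ j, (t j : ℝ) * u j))

section laplaceKernel

variable {n : ℕ}

theorem continuous_exp_neg_sum (t : Fin n → ℝ≥0) :
    Continuous fun u : Fin n → ℝ≥0 => Real.exp (-∑ j, (t j : ℝ) * u j) := by
  fun_prop

@[fun_prop]
theorem measurable_laplaceKernel (t : Fin n → ℝ≥0) : Measurable (laplaceKernel t) :=
  (continuous_exp_neg_sum t).measurable.ennreal_ofReal

theorem laplaceKernel_add (s t u : Fin n → ℝ≥0) :
    laplaceKernel (s + t) u = laplaceKernel s u * laplaceKernel t u := by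
  rw [laplaceKernel, laplaceKernel, laplaceKernel, ← ENNReal.ofReal_mul (Real.exp_pos _).le,
    ← Real.exp_add]
  simp [add_mul, Finset.sum_add_distrib, add_comm]

theorem sum_mul_nonneg (t u : Fin n → ℝ≥0) : 0 ≤ ∑ j, (t j : ℝ) * u j :=
  Finset.sum_nonneg fun _ _ => by positivity

theorem laplaceKernel_le_one (t u : Fin n → ℝ≥0) : laplaceKernel t u ≤ 1 := by
  rw [laplaceKernel, ← ENNReal.ofReal_one]
  exact ENNReal.ofReal_le_ofReal (Real.exp_le_one_iff.2 (by linarith [sum_mul_nonneg t u]))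

theorem laplaceKernel_ne_zero (t u : Fin n → ℝ≥0) : laplaceKernel t u ≠ 0 := by
  simp [laplaceKernel, Real.exp_pos]

theorem laplaceKernel_ne_top (t u : Fin n → ℝ≥0) : laplaceKernel t u ≠ ⊤ :=
  ENNReal.ofReal_ne_top

theorem laplaceKernel_apply_zero (t : Fin n → ℝ≥0) : laplaceKernel t 0 = 1 := by
  simp [laplaceKernel]

theorem one_sub_laplaceKernel (t u : Fin n → ℝ≥0) :
    1 - laplaceKernel t u = ENNReal.ofReal (1 - Real.exp (-∑ j, (t j : ℝ) * u j)) := by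
  rw [laplaceKernel, ENNReal.ofReal_sub _ (Real.exp_pos _).le, ENNReal.ofReal_one]

end laplaceKernel

/-- **Bernstein's theorem** for bounded completely monotone functions on `ℝ₊ⁿ`. -/
theorem exists_measure_lintegral_laplaceKernel_of_bounded {n : ℕ} {g : (Fin n → ℝ≥0) → ℝ}
    (hg : ∀ H t, 0 ≤ iterDiff H g t) :
    ∃ ρ : Measure (Fin n → ℝ≥0), ∀ t : Fin n → ℝ≥0, (∀ j, 0 < t j) →
      ∫⁻ u, laplaceKernel t u ∂ρ = ENNReal.ofReal (g t) := by
  rcases (nonneg_of_iterDiff_nonneg hg 0).eq_or_lt with h0 | h0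
  · refine ⟨0, fun t _ => ?_⟩
    have h1 := le_zero_of_iterDiff_nonneg hg t
    rw [← h0] at h1
    simp [ENNReal.ofReal_of_nonpos h1]
  have hbase : (fun t => (g 0)⁻¹ * g t) ∈ completelyMonotoneBase (Fin n → ℝ≥0) := by
    refine ⟨inv_mul_cancel₀ h0.ne', fun H t => ?_⟩
    rw [iterDiff_const_mul]
    exact mul_nonneg (inv_nonneg.2 h0.le) (hg H t)
  obtain ⟨ν, hν⟩ := exists_probabilityMeasure_of_completelyMonotone hbase
  -- The substitution `u = -log x` sends a zero coordinate to infinity. Points with such a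
  -- coordinate can be dropped, since `0 ^ t j = 0` for `t j > 0`.
  let P : Set (Fin n → I) := {x | ∀ j, (0 : ℝ) < x j}
  have hP : MeasurableSet P := by
    have : P = ⋂ j, {x | (0 : ℝ) < x j} := by ext; simp [P]
    rw [this]
    exact MeasurableSet.iInter fun j => measurableSet_lt measurable_const (by fun_prop)
  let L : (Fin n → I) → Fin n → ℝ≥0 := fun x j => Real.toNNReal (-Real.log (x j))
  have hL : Measurable L := measurable_pi_lambda _ fun j =>
    (Real.measurable_log.comp (by fun_prop)).neg.real_toNNReal
  refine ⟨ENNReal.ofReal (g 0) • ((ν : Measure (Fin n → I)).restrict P).map L, fun t ht => ?_⟩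
  rw [lintegral_smul_measure, lintegral_map (measurable_laplaceKernel t) hL]
  have hcongr : ∫⁻ x in P, laplaceKernel t (L x) ∂(ν : Measure (Fin n → I)) =
      ∫⁻ x, ENNReal.ofReal (∏ j, (x j : ℝ) ^ (t j : ℝ)) ∂(ν : Measure (Fin n → I)) := by
    rw [← lintegral_indicator hP]
    refine lintegral_congr fun x => ?_
    by_cases hx : x ∈ P
    · rw [indicator_of_mem hx, laplaceKernel, ← Finset.sum_neg_distrib, Real.exp_sum]
      congr 1
      refine Finset.prod_congr rfl fun j _ => ?_
      rw [Real.rpow_def_of_pos (hx j)]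
      have : 0 ≤ -Real.log (x j) := by
        linarith [Real.log_nonpos (x j).2.1 (x j).2.2]
      simp only [L, Real.coe_toNNReal _ this]
      congr 1; ring
    · rw [indicator_of_notMem hx]
      simp only [P, mem_ofPred_eq, not_forall, not_lt] at hx
      obtain ⟨j, hj⟩ := hx
      have hj0 : (x j : ℝ) = 0 := le_antisymm hj (x j).2.1
      rw [Finset.prod_eq_zero (Finset.mem_univ j), ENNReal.ofReal_zero]
      rw [hj0, Real.zero_rpow (by exact_mod_cast (ht j).ne')]
  rw [hcongr, ← ofReal_integral_eq_lintegral_ofReal, hν t ht, smul_eq_mul,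
    ← ENNReal.ofReal_mul h0.le, mul_inv_cancel_left₀ h0.ne']
  · exact (BoundedContinuousFunction.mkOfCompact ⟨_, continuous_prod_rpow t⟩).integrable _
  · exact ae_of_all _ fun x => Finset.prod_nonneg fun j _ => Real.rpow_nonneg (x j).2.1 _

/-! ### Uniqueness of Laplace transforms and Bernstein's theorem on the open orthant. -/

/-- Finite measures on `ℝ₊ⁿ` are determined by their Laplace transforms. -/
theorem ext_of_lintegral_laplaceKernel_of_finite {n : ℕ} {ρ₁ ρ₂ : Measure (Fin n → ℝ≥0)}
    [IsFiniteMeasure ρ₁] [IsFiniteMeasure ρ₂]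
    (h : ∀ t, ∫⁻ u, laplaceKernel t u ∂ρ₁ = ∫⁻ u, laplaceKernel t u ∂ρ₂) : ρ₁ = ρ₂ := by
  let f : Multiplicative (Fin n → ℝ≥0) →* BoundedContinuousFunction (Fin n → ℝ≥0) ℝ :=
    { toFun := fun t => BoundedContinuousFunction.ofNormedAddCommGroup
        (fun u => Real.exp (-∑ j, (t.toAdd j : ℝ) * u j)) (continuous_exp_neg_sum _) 1
        (fun u => by
          rw [Real.norm_eq_abs, Real.abs_exp, Real.exp_le_one_iff]
          linarith [sum_mul_nonneg t.toAdd u])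
      map_one' := by ext u; simp
      map_mul' := fun s t => by
        ext u
        simp [← Real.exp_add, add_mul, Finset.sum_add_distrib, add_comm] }
  have hf : ∀ t u, f t u = Real.exp (-∑ j, (t.toAdd j : ℝ) * u j) := fun _ _ => rfl
  let B : Subalgebra ℝ (BoundedContinuousFunction (Fin n → ℝ≥0) ℝ) := Algebra.adjoin ℝ (range f)
  let A : StarSubalgebra ℝ (BoundedContinuousFunction (Fin n → ℝ≥0) ℝ) :=
    { B with star_mem' := fun {a} ha => by rwa [show star a = a from by ext; simp] }
  have hmem : ∀ t, f t ∈ A := fun t => Algebra.subset_adjoin (mem_range_self t)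
  refine ext_of_forall_mem_subalgebra_integral_eq_of_polish (𝕜 := ℝ) (A := A) ?_ ?_
  · intro u v huv
    obtain ⟨j, hj⟩ := Function.ne_iff.1 huv
    refine ⟨_, ⟨_, ⟨f (Multiplicative.ofAdd (Pi.single j 1)), hmem _, rfl⟩, rfl⟩, ?_⟩
    change f _ u ≠ f _ v
    rw [hf, hf]
    intro he
    have := Real.exp_injective he
    rw [neg_inj, Finset.sum_eq_single j (fun i _ hi => by simp [hi]) (by simp),
      Finset.sum_eq_single j (fun i _ hi => by simp [hi]) (by simp)] at this
    simp only [toAdd_ofAdd, Pi.single_eq_same, NNReal.coe_one, one_mul] at this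
    exact hj (NNReal.coe_injective this)
  · intro g hg
    -- The exponentials are closed under multiplication, so the algebra they generate is their
    -- linear span, and equality of integrals need only be checked on exponentials.
    have hg' : g ∈ Submodule.span ℝ (range f) := by
      have : g ∈ Subalgebra.toSubmodule B := hg
      rw [Algebra.adjoin_eq_span, ← MonoidHom.coe_mrange, Submonoid.closure_eq] at this
      exact this
    induction hg' using Submodule.span_induction with
    | mem x hx =>
      obtain ⟨t, rfl⟩ := hx
      have := h t.toAdd
      simp only [hf]
      rw [integral_eq_lintegral_of_nonneg_ae (ae_of_all _ fun _ => (Real.exp_pos _).le)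
        (continuous_exp_neg_sum _).aestronglyMeasurable,
        integral_eq_lintegral_of_nonneg_ae (ae_of_all _ fun _ => (Real.exp_pos _).le)
        (continuous_exp_neg_sum _).aestronglyMeasurable]
      exact congrArg _ this
    | zero => simp
    | add x y hx hy ihx ihy =>
      simp only [BoundedContinuousFunction.coe_add, Pi.add_apply]
      rw [integral_add (x.integrable _) (y.integrable _),
        integral_add (x.integrable _) (y.integrable _)]
      have hm : ∀ x ∈ Submodule.span ℝ (range f), x ∈ A := fun x hx => by
        change x ∈ Subalgebra.toSubmodule B
        rw [Algebra.adjoin_eq_span]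
        exact Submodule.span_mono Submonoid.subset_closure hx
      rw [ihx (hm x hx), ihy (hm y hy)]
    | smul a x hx ih =>
      simp only [BoundedContinuousFunction.coe_smul]
      rw [integral_smul, integral_smul, ih]
      change x ∈ Subalgebra.toSubmodule B
      rw [Algebra.adjoin_eq_span]
      exact Submodule.span_mono Submonoid.subset_closure hx

/-- The almost-everywhere form allows a density that vanishes at the origin, such as `1 -
laplaceKernel 1`, once the measure is restricted to the complement. -/
theorem withDensity_mul_cancel {α : Type*} [MeasurableSpace α] (ρ : Measure α) {f g : α → ℝ≥0∞}
    (hf : Measurable f) (hg : Measurable g) (h : ∀ᵐ x ∂ρ, f x * g x = 1) :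
    (ρ.withDensity f).withDensity g = ρ := by
  have h' : f * g =ᵐ[ρ] 1 := h
  rw [← withDensity_mul _ hf hg, withDensity_congr_ae h', withDensity_one]

/-- Measures on `ℝ₊ⁿ` are determined by their Laplace transforms on a translated orthant. -/
theorem ext_of_lintegral_laplaceKernel {n : ℕ} {ρ₁ ρ₂ : Measure (Fin n → ℝ≥0)} (a : Fin n → ℝ≥0)
    (h : ∀ t, ∫⁻ u, laplaceKernel (a + t) u ∂ρ₁ = ∫⁻ u, laplaceKernel (a + t) u ∂ρ₂)
    (hfin : ∫⁻ u, laplaceKernel a u ∂ρ₁ ≠ ⊤) : ρ₁ = ρ₂ := by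
  have hfin₂ : ∫⁻ u, laplaceKernel a u ∂ρ₂ ≠ ⊤ := by
    have := h 0; simp only [add_zero] at this; rwa [← this]
  have : IsFiniteMeasure (ρ₁.withDensity (laplaceKernel a)) := isFiniteMeasure_withDensity hfin
  have : IsFiniteMeasure (ρ₂.withDensity (laplaceKernel a)) := isFiniteMeasure_withDensity hfin₂
  have key : ρ₁.withDensity (laplaceKernel a) = ρ₂.withDensity (laplaceKernel a) := by
    refine ext_of_lintegral_laplaceKernel_of_finite fun t => ?_
    rw [lintegral_withDensity_eq_lintegral_mul _ (by fun_prop) (by fun_prop),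
      lintegral_withDensity_eq_lintegral_mul _ (by fun_prop) (by fun_prop)]
    simpa only [Pi.mul_apply, ← laplaceKernel_add] using h t
  have hc : ∀ ρ : Measure (Fin n → ℝ≥0), (ρ.withDensity (laplaceKernel a)).withDensity
      (fun u => (laplaceKernel a u)⁻¹) = ρ := fun ρ =>
    withDensity_mul_cancel ρ (by fun_prop) (by fun_prop) (ae_of_all _ fun u =>
      ENNReal.mul_inv_cancel (laplaceKernel_ne_zero a u) (laplaceKernel_ne_top a u))
  rw [← hc ρ₁, key, hc]

/-- **Bernstein's theorem** for completely monotone functions on the open orthant. -/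
theorem exists_measure_lintegral_laplaceKernel {n : ℕ} {F : (Fin n → ℝ≥0) → ℝ}
    (hF : ∀ H t, (∀ j, 0 < t j) → 0 ≤ iterDiff H F t) :
    ∃ ρ : Measure (Fin n → ℝ≥0), ∀ t : Fin n → ℝ≥0, (∀ j, 0 < t j) →
      ∫⁻ u, laplaceKernel t u ∂ρ = ENNReal.ofReal (F t) := by
  have h1 : ∀ ε : Fin n → ℝ≥0, (∀ j, 0 < ε j) → ∃ ρ : Measure (Fin n → ℝ≥0),
      ∀ t : Fin n → ℝ≥0, (∀ j, 0 < t j) →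
      ∫⁻ u, laplaceKernel (t + ε) u ∂ρ = ENNReal.ofReal (F (t + ε)) := by
    intro ε hε
    obtain ⟨ν, hν⟩ := exists_measure_lintegral_laplaceKernel_of_bounded
      (g := fun t => F (t + ε)) (fun H t => by
        rw [iterDiff_shift]
        exact hF H _ fun j => add_pos_of_nonneg_of_pos zero_le (hε j))
    refine ⟨ν.withDensity fun u => (laplaceKernel ε u)⁻¹, fun t ht => ?_⟩
    rw [lintegral_withDensity_eq_lintegral_mul _ (by fun_prop) (by fun_prop), ← hν t ht]
    refine lintegral_congr fun u => ?_
    rw [Pi.mul_apply, laplaceKernel_add, mul_comm, mul_assoc,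
      ENNReal.mul_inv_cancel (laplaceKernel_ne_zero ε u) (laplaceKernel_ne_top ε u), mul_one]
  choose! ρ hρ using h1
  -- Both measures have transform `F` on the orthant translated by `ε + ε'`, so they coincide. Hence
  -- one measure serves every `t`, taking `ε = t / 2`.
  have h2 : ∀ ε ε' : Fin n → ℝ≥0, (∀ j, 0 < ε j) → (∀ j, 0 < ε' j) → ρ ε = ρ ε' := by
    intro ε ε' hε hε'
    have hl : ∀ t, ∫⁻ u, laplaceKernel (ε + ε' + t) u ∂(ρ ε) =
        ENNReal.ofReal (F (ε + ε' + t)) := by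
      intro t
      have := hρ ε hε (ε' + t) fun j => add_pos_of_pos_of_nonneg (hε' j) zero_le
      rwa [show ε' + t + ε = ε + ε' + t by abel] at this
    have hl' : ∀ t, ∫⁻ u, laplaceKernel (ε + ε' + t) u ∂(ρ ε') =
        ENNReal.ofReal (F (ε + ε' + t)) := by
      intro t
      have := hρ ε' hε' (ε + t) fun j => add_pos_of_pos_of_nonneg (hε j) zero_le
      rwa [show ε + t + ε' = ε + ε' + t by abel] at this
    refine ext_of_lintegral_laplaceKernel (ε + ε') (fun t => by rw [hl, hl']) ?_
    have := hl 0
    rw [add_zero] at this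
    rw [this]
    exact ENNReal.ofReal_ne_top
  refine ⟨ρ 1, fun t ht => ?_⟩
  have ht2 : ∀ j, 0 < (t / 2) j := fun j => by
    simpa using ht j
  have := hρ (t / 2) ht2 (t / 2) ht2
  rwa [show t / 2 + t / 2 = t by ext j; simp, h2 _ 1 ht2 (fun _ => one_pos)] at this

/-! ### The Lévy–Khinchin representation from differences. -/

theorem lintegral_eq_apply_zero_add {n : ℕ} (ρ : Measure (Fin n → ℝ≥0)) {f : (Fin n → ℝ≥0) → ℝ≥0∞} :
    ∫⁻ u, f u ∂ρ = f 0 * ρ {0} + ∫⁻ u in {0}ᶜ, f u ∂ρ := by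
  rw [← lintegral_add_compl f (measurableSet_singleton 0), lintegral_singleton]

/-- The constant vector `(1 / (m + 1), …, 1 / (m + 1))`. -/
noncomputable def constInv (n m : ℕ) : Fin n → ℝ≥0 := fun _ => 1 / ((m : ℝ≥0) + 1)

theorem antitone_constInv (n : ℕ) : Antitone (constInv n) := by
  intro m m' h j
  have : (m : ℝ≥0) + 1 ≤ m' + 1 := by exact_mod_cast Nat.succ_le_succ h
  exact one_div_le_one_div_of_le (by positivity) this

theorem laplaceKernel_constInv_mono {n : ℕ} (u : Fin n → ℝ≥0) :
    Monotone fun m => laplaceKernel (constInv n m) u := by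
  intro m m' h
  refine ENNReal.ofReal_le_ofReal (Real.exp_le_exp.2 (neg_le_neg ?_))
  refine Finset.sum_le_sum fun j _ => mul_le_mul_of_nonneg_right ?_ (u j).2
  exact_mod_cast antitone_constInv n h j

theorem tendsto_laplaceKernel_constInv {n : ℕ} (u : Fin n → ℝ≥0) :
    Tendsto (fun m => laplaceKernel (constInv n m) u) atTop (𝓝 1) := by
  have h : Tendsto (fun m : ℕ => Real.exp (-∑ j, (constInv n m j : ℝ) * u j)) atTop
      (𝓝 (Real.exp (-∑ j : Fin n, (0 : ℝ) * u j))) := by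
    refine (Real.continuous_exp.tendsto _).comp (Tendsto.neg ?_)
    refine tendsto_finsetSum _ fun j _ => Tendsto.mul_const _ ?_
    simpa [constInv] using tendsto_one_div_add_atTop_nhds_zero_nat (𝕜 := ℝ)
  have := ENNReal.tendsto_ofReal h
  simpa [laplaceKernel] using this

/-- Lévy–Khinchin type representation on the open orthant of a function with completely
monotone differences. -/
theorem exists_levyKhinchin {n : ℕ} {F : (Fin n → ℝ≥0) → ℝ}
    (hF : ∀ h H t, (∀ j, 0 < t j) → 0 ≤ iterDiff (h :: H) F t)
    (hle : ∀ t, (∀ j, 0 < t j) → F t ≤ 0)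
    (hcont : ∀ h, (∀ j, 0 < h j) → Tendsto (fun m => F (constInv n m + h)) atTop (𝓝 (F h))) :
    ∃ (c₀ : ℝ) (c : Fin n → ℝ) (μ : Measure (Fin n → ℝ≥0)), c₀ ≤ 0 ∧ (∀ j, 0 ≤ c j) ∧
      ∀ h, (∀ j, 0 < h j) → F h ≤ c₀ ∧ ENNReal.ofReal (c₀ - F h) =
        ENNReal.ofReal (∑ j, c j * h j) + ∫⁻ u in {0}ᶜ, (1 - laplaceKernel h u) ∂μ := by
  have hpos : ∀ h t, (∀ j, 0 < t j) → F (t + h) ≤ F t := fun h t ht => by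
    have := hF h [] t ht
    simp only [iterDiff] at this
    linarith
  have hex : ∀ h, ∃ ν : Measure (Fin n → ℝ≥0), ∀ t : Fin n → ℝ≥0, (∀ j, 0 < t j) →
      ∫⁻ u, laplaceKernel t u ∂ν = ENNReal.ofReal (F t - F (t + h)) := fun h =>
    exists_measure_lintegral_laplaceKernel (F := fun t => F t - F (t + h)) fun H t ht =>
      hF h H t ht
  choose ν hν using hex
  have hadd_pos : ∀ t h : Fin n → ℝ≥0, (∀ j, 0 < t j) → ∀ j, 0 < (t + h) j := fun t h ht j =>
    add_pos_of_pos_of_nonneg (ht j) zero_le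
  have hfin : ∀ h t, (∀ j, 0 < t j) → ∫⁻ u, laplaceKernel t u ∂(ν h) ≠ ⊤ := fun h t ht => by
    rw [hν h t ht]; exact ENNReal.ofReal_ne_top
  have hone : ∀ j : Fin n, (0 : ℝ≥0) < (1 : Fin n → ℝ≥0) j := fun _ => one_pos
  have hsub : ∀ (ρ : Measure (Fin n → ℝ≥0)) t k, ∫⁻ u, laplaceKernel (t + k) u ∂ρ ≠ ⊤ →
      ∫⁻ u, laplaceKernel t u * (1 - laplaceKernel k u) ∂ρ =
        ∫⁻ u, laplaceKernel t u ∂ρ - ∫⁻ u, laplaceKernel (t + k) u ∂ρ := by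
    intro ρ t k hfin
    rw [← lintegral_sub (by fun_prop) hfin]
    · refine lintegral_congr fun u => ?_
      rw [ENNReal.mul_sub (fun _ _ => laplaceKernel_ne_top t u), mul_one, laplaceKernel_add]
    · refine ae_of_all _ fun u => ?_
      rw [laplaceKernel_add]
      exact mul_le_of_le_one_right' (laplaceKernel_le_one k u)
  -- symmetry of the family of representing measures
  have hsymm : ∀ h k, (ν h).withDensity (fun u => 1 - laplaceKernel k u) =
      (ν k).withDensity (fun u => 1 - laplaceKernel h u) := by
    intro h k
    have hcomp : ∀ h k t, (∀ j, 0 < t j) →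
        ∫⁻ u, laplaceKernel t u ∂((ν h).withDensity fun u => 1 - laplaceKernel k u) =
          ENNReal.ofReal ((F t - F (t + h)) - (F (t + k) - F (t + k + h))) := by
      intro h k t ht
      rw [lintegral_withDensity_eq_lintegral_mul _ (by fun_prop) (by fun_prop)]
      simp only [Pi.mul_apply, mul_comm (1 - laplaceKernel k _)]
      have htk := hadd_pos t k ht
      rw [hsub _ _ _ (hfin h _ htk), hν h t ht, hν h _ htk, ← ENNReal.ofReal_sub]
      linarith [hpos h _ htk]
    have hpos' : ∀ t : Fin n → ℝ≥0, ∀ j, 0 < (1 + t) j := fun t => hadd_pos 1 t hone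
    refine ext_of_lintegral_laplaceKernel 1 (fun t => ?_) ?_
    · rw [hcomp _ _ _ (hpos' t), hcomp _ _ _ (hpos' t), add_right_comm _ h k]
      congr 1; ring
    · rw [hcomp _ _ _ hone]; exact ENNReal.ofReal_ne_top
  -- This is the telescoping `F t - F (t + h + k) = (F t - F (t + h)) + (F (t + h) - F (t + h +
  -- k))`. The density is `1` at the origin, so the atoms there add.
  have hcocycle : ∀ h k, ν (h + k) = ν h + (ν k).withDensity (laplaceKernel h) := by
    intro h k
    have hpos' : ∀ t : Fin n → ℝ≥0, ∀ j, 0 < (1 + t) j := fun t => hadd_pos 1 t hone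
    refine ext_of_lintegral_laplaceKernel 1 (fun t => ?_) (hfin _ _ hone)
    have hth := hadd_pos _ h (hpos' t)
    rw [lintegral_add_measure, lintegral_withDensity_eq_lintegral_mul _ (by fun_prop)
      (by fun_prop)]
    simp only [Pi.mul_apply, mul_comm (laplaceKernel h _), ← laplaceKernel_add]
    rw [hν _ _ (hpos' t), hν _ _ (hpos' t), hν _ _ hth, ← ENNReal.ofReal_add, ← add_assoc]
    · congr 1; ring
    · linarith [hpos h _ (hpos' t)]
    · linarith [hpos k _ hth]
  have hatom_fin : ∀ h, ν h {0} ≠ ⊤ := by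
    intro h hh
    refine hfin h 1 hone ?_
    rw [lintegral_eq_apply_zero_add, laplaceKernel_apply_zero, hh]
    simp
  have hatom_add : ∀ h k, ν (h + k) {0} = ν h {0} + ν k {0} := by
    intro h k
    rw [hcocycle, Measure.add_apply, withDensity_apply _ (measurableSet_singleton 0),
      lintegral_singleton, laplaceKernel_apply_zero, one_mul]
  let a : (Fin n → ℝ≥0) → ℝ := fun h => (ν h {0}).toReal
  have ha_add : ∀ h k, a (h + k) = a h + a k := fun h k => by
    simp only [a]
    rw [hatom_add, ENNReal.toReal_add (hatom_fin h) (hatom_fin k)]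
  have ha_nn : ∀ h, 0 ≤ a h := fun h => ENNReal.toReal_nonneg
  have ha0 : a 0 = 0 := by have := ha_add 0 0; simp at this; exact this
  have ha : ∀ h, a h = ∑ j, a (Pi.single j 1) * h j := by
    intro h
    have hsum : ∀ (s : Finset (Fin n)) (v : Fin n → Fin n → ℝ≥0),
        a (∑ j ∈ s, v j) = ∑ j ∈ s, a (v j) := by
      intro s v
      induction s using Finset.induction_on with
      | empty => simp [ha0]
      | insert j s hj ih => rw [Finset.sum_insert hj, Finset.sum_insert hj, ha_add, ih]
    conv_lhs => rw [← Finset.univ_sum_single h]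
    rw [hsum]
    refine Finset.sum_congr rfl fun j _ => ?_
    rw [mul_comm]
    exact additive_nonneg_eq_mul (a := fun r => a (Pi.single j r))
      (fun s t => by rw [Pi.single_add, ha_add]) (fun _ => ha_nn _) (h j)
  let w : (Fin n → ℝ≥0) → ℝ≥0∞ := fun u => 1 - laplaceKernel 1 u
  have hw : Measurable w := by fun_prop
  have hw0 : ∀ u, u ≠ 0 → w u * (w u)⁻¹ = 1 := by
    intro u hu
    refine ENNReal.mul_inv_cancel ?_ (ne_top_of_le_ne_top ENNReal.one_ne_top tsub_le_self)
    simp only [w, one_sub_laplaceKernel]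
    rw [ne_eq, ENNReal.ofReal_eq_zero, not_le, sub_pos, Real.exp_lt_one_iff, neg_lt_zero]
    obtain ⟨j, hj⟩ := Function.ne_iff.1 hu
    refine Finset.sum_pos' (fun _ _ => by positivity) ⟨j, Finset.mem_univ j, ?_⟩
    have : (0 : ℝ) < u j := by exact_mod_cast pos_iff_ne_zero.2 hj
    simpa using this
  -- The weight `w` is positive off the origin, so it can be divided out of the symmetry relation
  -- for the pair `h`, `1`. The result is one `μ` that works for all `h`.
  let μ : Measure (Fin n → ℝ≥0) := ((ν 1).restrict {0}ᶜ).withDensity fun u => (w u)⁻¹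
  have hS : MeasurableSet ({0}ᶜ : Set (Fin n → ℝ≥0)) := (measurableSet_singleton 0).compl
  have hμ : ∀ h, (ν h).restrict {0}ᶜ =
      (μ.restrict {0}ᶜ).withDensity (fun u => 1 - laplaceKernel h u) := by
    intro h
    have hμr : μ.restrict {0}ᶜ = μ := by
      simp only [μ]
      rw [restrict_withDensity hS, Measure.restrict_restrict hS, inter_self]
    have h1 := withDensity_mul_cancel ((ν h).restrict {0}ᶜ) hw hw.inv
      ((ae_restrict_iff' hS).2 (ae_of_all _ fun u hu => hw0 u hu))
    rw [← h1, ← restrict_withDensity hS]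
    simp only [w]
    rw [hsymm h 1, restrict_withDensity hS, hμr]
    simp only [μ]
    rw [← withDensity_mul _ (by fun_prop) (by fun_prop),
      ← withDensity_mul _ (by fun_prop) (by fun_prop), mul_comm]
    rfl
  have hrep : ∀ h t, (∀ j, 0 < t j) → ENNReal.ofReal (F t - F (t + h)) =
      ENNReal.ofReal (a h) + ∫⁻ u in {0}ᶜ, laplaceKernel t u * (1 - laplaceKernel h u) ∂μ := by
    intro h t ht
    rw [← hν h t ht, lintegral_eq_apply_zero_add, laplaceKernel_apply_zero, one_mul, hμ,
      lintegral_withDensity_eq_lintegral_mul _ (by fun_prop) (by fun_prop),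
      ENNReal.ofReal_toReal (hatom_fin h)]
    simp only [Pi.mul_apply, mul_comm]
  have hci : ∀ m (j : Fin n), 0 < constInv n m j := fun m j => by
    simp only [constInv]; positivity
  have hmono : Monotone fun m => F (constInv n m) := by
    intro m m' hm
    obtain ⟨r, hr⟩ : ∃ r, constInv n m = constInv n m' + r :=
      exists_add_of_le (antitone_constInv n hm)
    simp only
    rw [hr]
    exact hpos _ _ (hci m')
  have hbdd : BddAbove (range fun m => F (constInv n m)) :=
    ⟨0, by rintro _ ⟨m, rfl⟩; exact hle _ (hci m)⟩
  have hlim := tendsto_atTop_ciSup hmono hbdd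
  set c₀ := ⨆ m, F (constInv n m) with hc₀
  refine ⟨c₀, fun j => a (Pi.single j 1), μ, ciSup_le fun m => hle _ (hci m), fun j => ha_nn _,
    fun h hh => ⟨?_, ?_⟩⟩
  · refine le_of_tendsto_of_tendsto' (hcont h hh) hlim fun m => hpos h _ (hci m)
  · rw [← ha]
    have h1 := ENNReal.tendsto_ofReal (hlim.sub (hcont h hh))
    -- Monotone convergence as `t` decreases to `0` along `constInv`. No integrability of the limit
    -- has to be known in advance.
    have h2 : Tendsto (fun m => ∫⁻ u in {0}ᶜ,
        laplaceKernel (constInv n m) u * (1 - laplaceKernel h u) ∂μ) atTop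
        (𝓝 (∫⁻ u in {0}ᶜ, (1 - laplaceKernel h u) ∂μ)) := by
      refine lintegral_tendsto_of_tendsto_of_monotone (fun m => by fun_prop)
        (ae_of_all _ fun u m m' hm => by
          simp only
          gcongr
          exact laplaceKernel_constInv_mono u hm)
        (ae_of_all _ fun u => ?_)
      have := ENNReal.Tendsto.mul_const (b := 1 - laplaceKernel h u)
        (tendsto_laplaceKernel_constInv u)
        (Or.inr (ne_top_of_le_ne_top ENNReal.one_ne_top tsub_le_self))
      simpa using this
    refine tendsto_nhds_unique h1 ?_
    simp only [hrep h _ (hci _)]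
    exact h2.const_add _

/-! ### From partial derivatives to iterated differences. -/

theorem isOpen_negOrthant (n : ℕ) : IsOpen (negOrthant n) := by
  have : negOrthant n = ⋂ j, {s | s j < 0} := by ext; simp [negOrthant]
  rw [this]
  exact isOpen_iInter_of_finite fun j => isOpen_lt (continuous_apply j) continuous_const

theorem sub_mem_negOrthant {n : ℕ} {s h : Fin n → ℝ} (hs : s ∈ negOrthant n) (hh : ∀ j, 0 ≤ h j) :
    s - h ∈ negOrthant n := fun j => by
  have := hs j; have := hh j; simp only [Pi.sub_apply]; linarith

theorem ContDiffOn.partialDeriv {n : ℕ} {f : (Fin n → ℝ) → ℝ}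
    (hf : ContDiffOn ℝ ∞ f (negOrthant n)) (i : Fin n) :
    ContDiffOn ℝ ∞ (partialDeriv i f) (negOrthant n) :=
  (hf.fderiv_of_isOpen (isOpen_negOrthant n) (by simp)).clm_apply contDiffOn_const

theorem ContDiffOn.iteratedPartialDeriv {n : ℕ} {f : (Fin n → ℝ) → ℝ}
    (hf : ContDiffOn ℝ ∞ f (negOrthant n)) (L : List (Fin n)) :
    ContDiffOn ℝ ∞ (iteratedPartialDeriv L f) (negOrthant n) := by
  induction L with
  | nil => exact hf
  | cons i L ih => exact ih.partialDeriv i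

theorem ContDiffOn.hasFDerivAt_negOrthant {n : ℕ} {f : (Fin n → ℝ) → ℝ}
    (hf : ContDiffOn ℝ ∞ f (negOrthant n)) {s : Fin n → ℝ} (hs : s ∈ negOrthant n) :
    HasFDerivAt f (fderiv ℝ f s) s :=
  ((hf.differentiableOn (by simp)).differentiableAt
    ((isOpen_negOrthant n).mem_nhds hs)).hasFDerivAt

theorem iteratedPartialDeriv_sub_shift {n : ℕ} {f : (Fin n → ℝ) → ℝ}
    (hf : ContDiffOn ℝ ∞ f (negOrthant n)) {h : Fin n → ℝ} (hh : ∀ j, 0 ≤ h j)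
    (L : List (Fin n)) : ∀ s ∈ negOrthant n,
    iteratedPartialDeriv L (fun s => f s - f (s - h)) s =
      iteratedPartialDeriv L f s - iteratedPartialDeriv L f (s - h) := by
  induction L with
  | nil => intro s _; rfl
  | cons i L ih =>
    intro s hs
    -- The induction hypothesis holds only on the orthant; since the orthant is open, it can still
    -- be differentiated at `s`.
    have he : iteratedPartialDeriv L (fun s => f s - f (s - h)) =ᶠ[𝓝 s]
        fun s => iteratedPartialDeriv L f s - iteratedPartialDeriv L f (s - h) :=
      Filter.eventually_of_mem ((isOpen_negOrthant n).mem_nhds hs) ih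
    have h1 := (hf.iteratedPartialDeriv L).hasFDerivAt_negOrthant hs
    have h2 := (hf.iteratedPartialDeriv L).hasFDerivAt_negOrthant (sub_mem_negOrthant hs hh)
    have h3 : HasFDerivAt (fun s => iteratedPartialDeriv L f (s - h)) _ s :=
      h2.comp s ((hasFDerivAt_id s).sub_const h)
    simp only [iteratedPartialDeriv, partialDeriv]
    rw [he.fderiv_eq, (h1.fun_sub h3).fderiv]
    simp

theorem le_of_partialDeriv_nonneg {n : ℕ} {f : (Fin n → ℝ) → ℝ}
    (hf : ContDiffOn ℝ ∞ f (negOrthant n))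
    (hd : ∀ i, ∀ s ∈ negOrthant n, 0 ≤ partialDeriv i f s) {s h : Fin n → ℝ}
    (hs : s ∈ negOrthant n) (hh : ∀ j, 0 ≤ h j) : f (s - h) ≤ f s := by
  let γ : ℝ → Fin n → ℝ := fun τ => s + τ • (-h)
  have hmem : ∀ τ, 0 ≤ τ → γ τ ∈ negOrthant n := fun τ hτ => by
    have := sub_mem_negOrthant (h := τ • h) hs fun j => mul_nonneg hτ (hh j)
    simpa [γ, sub_eq_add_neg] using this
  have hγ : ∀ τ, HasDerivAt γ (-h) τ := fun τ => by
    simpa [γ] using ((hasDerivAt_id τ).smul_const (-h)).const_add s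
  have hderiv : ∀ τ, 0 ≤ τ → HasDerivAt (fun τ => f (γ τ)) (fderiv ℝ f (γ τ) (-h)) τ :=
    fun τ hτ => (hf.hasFDerivAt_negOrthant (hmem τ hτ)).comp_hasDerivAt τ (hγ τ)
  have hle : ∀ τ, 0 ≤ τ → fderiv ℝ f (γ τ) (-h) ≤ 0 := fun τ hτ => by
    rw [map_neg, neg_nonpos, ← Finset.univ_sum_single h, map_sum]
    refine Finset.sum_nonneg fun i _ => ?_
    have : (Pi.single i (h i) : Fin n → ℝ) = h i • Pi.single i (1 : ℝ) := by
      rw [← Pi.single_smul]; simp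
    rw [this, map_smul]
    exact mul_nonneg (hh i) (hd i _ (hmem τ hτ))
  have hanti : AntitoneOn (fun τ => f (γ τ)) (Ici 0) := by
    refine antitoneOn_of_deriv_nonpos (convex_Ici 0)
      (fun τ hτ => (hderiv τ hτ).continuousAt.continuousWithinAt) ?_ ?_
    · intro τ hτ
      rw [interior_Ici] at hτ
      exact (hderiv τ hτ.le).differentiableAt.differentiableWithinAt
    · intro τ hτ
      rw [interior_Ici] at hτ
      rw [(hderiv τ hτ.le).deriv]
      exact hle τ hτ.le
  have := hanti (mem_Ici.2 le_rfl) (mem_Ici.2 zero_le_one) zero_le_one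
  simpa [γ, sub_eq_add_neg] using this

/-- Differences of a function with nonnegative partial derivatives of positive order are absolutely
monotone. -/
theorem isAbsMonotone_sub_shift {n : ℕ} {f : (Fin n → ℝ) → ℝ}
    (hf : ContDiffOn ℝ ∞ f (negOrthant n))
    (hd : ∀ i L, ∀ s ∈ negOrthant n, 0 ≤ iteratedPartialDeriv (i :: L) f s)
    {h : Fin n → ℝ} (hh : ∀ j, 0 ≤ h j) : IsAbsMonotone fun s => f s - f (s - h) := by
  refine ⟨hf.sub (hf.comp (contDiff_id.sub contDiff_const).contDiffOn
    fun s hs => sub_mem_negOrthant hs hh), fun L s hs => ?_⟩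
  rw [iteratedPartialDeriv_sub_shift hf hh L s hs, sub_nonneg]
  exact le_of_partialDeriv_nonneg (hf.iteratedPartialDeriv L) (fun i => hd i L) hs hh

theorem neg_mem_negOrthant {n : ℕ} {t : Fin n → ℝ≥0} (ht : ∀ j, 0 < t j) :
    (fun j => -(t j : ℝ)) ∈ negOrthant n := fun j => by
  have : (0 : ℝ) < t j := by exact_mod_cast ht j
  simpa using this

theorem neg_add_eq_sub_shift {n : ℕ} (t h : Fin n → ℝ≥0) :
    (fun j => -((t + h) j : ℝ)) = (fun j => -(t j : ℝ)) - fun j => (h j : ℝ) := by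
  ext j; simp [sub_eq_add_neg, add_comm]

/-- Subtracting a backward shift preserves absolute monotonicity, so each difference operator can be
absorbed into `f`. -/
theorem IsAbsMonotone.iterDiff_nonneg {n : ℕ} {f : (Fin n → ℝ) → ℝ} (hf : IsAbsMonotone f)
    (H : List (Fin n → ℝ≥0)) {t : Fin n → ℝ≥0} (ht : ∀ j, 0 < t j) :
    0 ≤ iterDiff H (fun t => f fun j => -(t j : ℝ)) t := by
  induction H generalizing f with
  | nil => exact hf.2 [] _ (neg_mem_negOrthant ht)
  | cons h H ih =>
    simp only [iterDiff, neg_add_eq_sub_shift]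
    exact ih (isAbsMonotone_sub_shift hf.1 (fun i L => hf.2 (i :: L)) fun j => (h j).2)

theorem iteratedPartialDeriv_append {n : ℕ} (L L' : List (Fin n)) (f : (Fin n → ℝ) → ℝ) :
    iteratedPartialDeriv (L ++ L') f = iteratedPartialDeriv L (iteratedPartialDeriv L' f) := by
  induction L with
  | nil => rfl
  | cons i L ih => simp only [List.cons_append, iteratedPartialDeriv, ih]

/-- The last entry of the list is the derivative applied first. Splitting it off reaches the
hypothesis on first-order derivatives without commuting partials. -/
theorem IsNegBernstein.iteratedPartialDeriv_cons_nonneg {n : ℕ} {ψ : (Fin n → ℝ) → ℝ}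
    (hψ : IsNegBernstein ψ) (i : Fin n) (L : List (Fin n)) {s : Fin n → ℝ}
    (hs : s ∈ negOrthant n) : 0 ≤ iteratedPartialDeriv (i :: L) ψ s := by
  obtain ⟨L', k, h⟩ : ∃ L' k, i :: L = L' ++ [k] :=
    ⟨_, _, (List.dropLast_append_getLast (List.cons_ne_nil i L)).symm⟩
  rw [h, iteratedPartialDeriv_append]
  exact (hψ.partialDeriv_absMonotone k).2 L' s hs

/-! ### Integrability conditions on a Lévy measure. -/

/-- The weight `min 1 (u₁ + ⋯ + uₙ)`, integrable for every Lévy measure on the orthant. -/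
noncomputable def levyWeight {n : ℕ} (u : Fin n → ℝ) : ℝ := min 1 (∑ j, u j)

section levyWeight

variable {n : ℕ}

theorem continuous_levyWeight : Continuous (levyWeight (n := n)) := by
  unfold levyWeight; fun_prop

theorem levyWeight_nonneg {u : Fin n → ℝ} (hu : ∀ j, 0 ≤ u j) : 0 ≤ levyWeight u :=
  le_min zero_le_one (Finset.sum_nonneg fun j _ => hu j)

theorem measurableSet_puncturedOrthant : MeasurableSet (puncturedOrthant n) := by
  have : puncturedOrthant n = (⋂ j, {u | 0 ≤ u j}) ∩ {0}ᶜ := by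
    ext; simp [puncturedOrthant]
  rw [this]
  exact (MeasurableSet.iInter fun j => measurableSet_le measurable_const
    (measurable_pi_apply j)).inter (measurableSet_singleton 0).compl

theorem measurableSet_cube (δ : ℝ) : MeasurableSet (cube n δ) := by
  have : cube n δ = ⋂ j, {u | 0 ≤ u j} ∩ {u | u j < δ} := by
    ext; simp [cube]
  rw [this]
  exact MeasurableSet.iInter fun j => (measurableSet_le measurable_const
    (measurable_pi_apply j)).inter (measurableSet_lt (measurable_pi_apply j) measurable_const)

theorem le_sum_of_nonneg {u : Fin n → ℝ} (hu : ∀ j, 0 ≤ u j) (j : Fin n) : u j ≤ ∑ j, u j :=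
  Finset.single_le_sum (fun j _ => hu j) (Finset.mem_univ j)

theorem integrableOn_levyWeight {μ : Measure (Fin n → ℝ)}
    (h1 : ∀ᶠ δ : ℝ in 𝓝[>] 0, ∀ j : Fin n,
      IntegrableOn (fun u => u j) (puncturedOrthant n ∩ cube n δ) μ)
    (h2 : ∀ᶠ δ : ℝ in 𝓝[>] 0, μ (puncturedOrthant n \ cube n δ) < ⊤) :
    IntegrableOn levyWeight (puncturedOrthant n) μ := by
  obtain ⟨δ, hδ1, hδ2⟩ := (h1.and h2).exists
  rw [← inter_union_sdiff (puncturedOrthant n) (cube n δ)]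
  have hP := measurableSet_puncturedOrthant (n := n)
  refine IntegrableOn.union ?_ ?_
  · have hs : IntegrableOn (fun u => ∑ j, u j) (puncturedOrthant n ∩ cube n δ) μ :=
      integrable_finsetSum _ fun j _ => hδ1 j
    refine Integrable.mono' hs continuous_levyWeight.aestronglyMeasurable ?_
    refine (ae_restrict_iff' (hP.inter (measurableSet_cube δ))).2 (ae_of_all _ fun u hu => ?_)
    rw [Real.norm_of_nonneg (levyWeight_nonneg hu.1.1)]
    exact min_le_right _ _
  · have hs : IntegrableOn (fun _ => (1 : ℝ)) (puncturedOrthant n \ cube n δ) μ :=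
      integrableOn_const hδ2.ne
    refine Integrable.mono' hs continuous_levyWeight.aestronglyMeasurable ?_
    refine (ae_restrict_iff' (hP.diff (measurableSet_cube δ))).2 (ae_of_all _ fun u hu => ?_)
    rw [Real.norm_of_nonneg (levyWeight_nonneg hu.1.1)]
    exact min_le_left _ _

theorem integrableOn_coord_of_levyWeight {μ : Measure (Fin n → ℝ)}
    (h : IntegrableOn levyWeight (puncturedOrthant n) μ) :
    ∀ᶠ δ : ℝ in 𝓝[>] 0, ∀ j : Fin n,
      IntegrableOn (fun u => u j) (puncturedOrthant n ∩ cube n δ) μ := by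
  -- Any bound at most `1` would do: `u j ≤ 1` and `u j ≤ ∑ j, u j` together give `u j ≤ levyWeight
  -- u`.
  have hlt : ∀ᶠ δ : ℝ in 𝓝[>] 0, δ < 1 / ((n : ℝ) + 1) :=
    nhdsWithin_le_nhds (Iio_mem_nhds (by positivity))
  filter_upwards [hlt, self_mem_nhdsWithin] with δ hδ hδ0 j
  refine Integrable.mono' (h.mono_set inter_subset_left)
    (measurable_pi_apply j).aestronglyMeasurable ?_
  refine (ae_restrict_iff' (measurableSet_puncturedOrthant.inter (measurableSet_cube δ))).2
    (ae_of_all _ fun u hu => ?_)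
  rw [Real.norm_of_nonneg (hu.1.1 j)]
  refine le_min ?_ (le_sum_of_nonneg hu.1.1 j)
  refine ((hu.2 j).2.trans hδ).le.trans ?_
  rw [div_le_one (by positivity)]
  linarith [Nat.cast_nonneg (α := ℝ) n]

/-- Outside the cube some coordinate is at least `δ`, so the weight is at least `min 1 δ`; Markov's
inequality applies. -/
theorem measure_diff_cube_lt_top_of_levyWeight {μ : Measure (Fin n → ℝ)}
    (h : IntegrableOn levyWeight (puncturedOrthant n) μ) :
    ∀ᶠ δ : ℝ in 𝓝[>] 0, μ (puncturedOrthant n \ cube n δ) < ⊤ := by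
  filter_upwards [self_mem_nhdsWithin] with δ (hδ : 0 < δ)
  have hlt := Integrable.measure_ge_lt_top h (ε := min 1 δ) (lt_min one_pos hδ)
  refine lt_of_le_of_lt ?_ hlt
  rw [Measure.restrict_apply (measurableSet_le measurable_const
    continuous_levyWeight.measurable)]
  refine measure_mono fun u hu => ⟨?_, hu.1⟩
  obtain ⟨j, hj⟩ : ∃ j, δ ≤ u j := by
    by_contra! hc
    exact hu.2 fun j => ⟨hu.1.1 j, hc j⟩
  exact min_le_min_left _ (hj.trans (le_sum_of_nonneg hu.1.1 j))

/-- With `x = ∑ j, u j`, one has `1 - e^{-x} ≥ x / (1 + x) ≥ min 1 x / 2`. Thus the representation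
at the single point `t = 1` already makes the weight integrable. -/
theorem levyWeight_le {u : Fin n → ℝ} (hu : ∀ j, 0 ≤ u j) :
    levyWeight u ≤ 2 * (1 - Real.exp (-∑ j, u j)) := by
  have hx : 0 ≤ ∑ j, u j := Finset.sum_nonneg fun j _ => hu j
  unfold levyWeight
  set x := ∑ j, u j
  have he : Real.exp (-x) ≤ (1 + x)⁻¹ := by
    rw [Real.exp_neg]
    exact inv_anti₀ (by linarith) (by linarith [Real.add_one_le_exp x])
  have : min 1 x ≤ 2 * (1 - (1 + x)⁻¹) := by
    have h1 : 1 - (1 + x)⁻¹ = x / (1 + x) := by field_simp; ring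
    rw [h1, ← mul_div_assoc, le_div_iff₀ (by linarith)]
    rcases le_total x 1 with h | h
    · rw [min_eq_right h]; nlinarith
    · rw [min_eq_left h]; linarith
  linarith

end levyWeight

/-! ### Existence of the integral representation. -/

theorem IsNegBernstein.exists_levyKhinchin {n : ℕ} {ψ : (Fin n → ℝ) → ℝ}
    (hψ : IsNegBernstein ψ) :
    ∃ (c₀ : ℝ) (c : Fin n → ℝ) (μ : Measure (Fin n → ℝ≥0)), c₀ ≤ 0 ∧ (∀ j, 0 ≤ c j) ∧
      ∀ t : Fin n → ℝ≥0, (∀ j, 0 < t j) → ψ (fun j => -(t j : ℝ)) ≤ c₀ ∧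
        ENNReal.ofReal (c₀ - ψ fun j => -(t j : ℝ)) =
          ENNReal.ofReal (∑ j, c j * t j) + ∫⁻ u in {0}ᶜ, (1 - laplaceKernel t u) ∂μ := by
  refine _root_.exists_levyKhinchin (F := fun t : Fin n → ℝ≥0 => ψ fun j => -(t j : ℝ)) ?_ ?_ ?_
  · intro h H t ht
    simp only [iterDiff, neg_add_eq_sub_shift]
    exact (isAbsMonotone_sub_shift hψ.contDiffOn
      (fun i L s hs => hψ.iteratedPartialDeriv_cons_nonneg i L hs)
      (fun j => (h j).2)).iterDiff_nonneg H ht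
  · exact fun t ht => hψ.nonpos _ (neg_mem_negOrthant ht)
  · intro h hh
    have hc := (hψ.contDiffOn.hasFDerivAt_negOrthant (neg_mem_negOrthant hh)).continuousAt
    refine hc.tendsto.comp (tendsto_pi_nhds.2 fun j => ?_)
    have : Tendsto (fun m => -((constInv n m j : ℝ) + h j)) atTop (𝓝 (-(0 + h j))) := by
      refine (Tendsto.add_const _ ?_).neg
      simpa [constInv] using tendsto_one_div_add_atTop_nhds_zero_nat (𝕜 := ℝ)
    simpa using this

/-- Existence of the integral representation. -/
theorem IsNegBernstein.exists_isBernsteinRep {n : ℕ} {ψ : (Fin n → ℝ) → ℝ}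
    (hψ : IsNegBernstein ψ) :
    ∃ (c₀ : ℝ) (c₁ : Fin n → ℝ) (μ : Measure (Fin n → ℝ)), IsBernsteinRep ψ c₀ c₁ μ := by
  obtain ⟨c₀, c, μ, hc₀, hc, hrep⟩ := hψ.exists_levyKhinchin
  let ι : (Fin n → ℝ≥0) → Fin n → ℝ := fun u j => u j
  have hι : Measurable ι := by fun_prop
  have hP := measurableSet_puncturedOrthant (n := n)
  have hpre : ι ⁻¹' puncturedOrthant n = {0}ᶜ := by
    ext u
    simp [ι, puncturedOrthant, funext_iff]
  let κ := (μ.restrict {0}ᶜ).map ι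
  have hκ : κ.restrict (puncturedOrthant n) = κ := by
    simp only [κ]
    rw [Measure.restrict_map hι hP, hpre, Measure.restrict_restrict
      (measurableSet_singleton 0).compl, inter_self]
  have hnn : ∀ᵐ u ∂κ, ∀ j, 0 ≤ u j := by
    rw [← hκ]
    exact (ae_restrict_iff' hP).2 (ae_of_all _ fun u hu => hu.1)
  have hlint : ∀ t : Fin n → ℝ≥0,
      ∫⁻ u, ENNReal.ofReal (1 - Real.exp (-∑ j, (t j : ℝ) * u j)) ∂κ =
        ∫⁻ u in {0}ᶜ, (1 - laplaceKernel t u) ∂μ := by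
    intro t
    rw [lintegral_map (by fun_prop) hι]
    exact lintegral_congr fun u => (one_sub_laplaceKernel t u).symm
  have hnn1 : ∀ t : Fin n → ℝ≥0, ∀ᵐ u ∂κ, 0 ≤ 1 - Real.exp (-∑ j, (t j : ℝ) * u j) := by
    intro t
    filter_upwards [hnn] with u hu
    rw [sub_nonneg, Real.exp_le_one_iff, neg_nonpos]
    exact Finset.sum_nonneg fun j _ => mul_nonneg (t j).2 (hu j)
  have hmeas : ∀ t : Fin n → ℝ≥0,
      AEStronglyMeasurable (fun u => 1 - Real.exp (-∑ j, (t j : ℝ) * u j)) κ := fun t =>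
    Continuous.aestronglyMeasurable (by fun_prop)
  have hfin : ∀ t : Fin n → ℝ≥0, (∀ j, 0 < t j) →
      ∫⁻ u, ENNReal.ofReal (1 - Real.exp (-∑ j, (t j : ℝ) * u j)) ∂κ ≠ ⊤ := by
    intro t ht h
    have h2 := (hrep t ht).2
    rw [← hlint, h, add_top] at h2
    exact ENNReal.ofReal_ne_top h2
  have hint : Integrable (fun u => 1 - Real.exp (-∑ j, u j)) κ := by
    have := (lintegral_ofReal_ne_top_iff_integrable (hmeas 1) (hnn1 1)).1
      (hfin 1 fun _ => one_pos)
    simpa using this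
  have hlevy : IntegrableOn levyWeight (puncturedOrthant n) κ := by
    rw [IntegrableOn, hκ]
    refine Integrable.mono' (hint.const_mul 2) continuous_levyWeight.aestronglyMeasurable ?_
    filter_upwards [hnn] with u hu
    rw [Real.norm_of_nonneg (levyWeight_nonneg hu)]
    exact levyWeight_le hu
  refine ⟨c₀, c, κ, hc₀, hc, integrableOn_coord_of_levyWeight hlevy,
    measure_diff_cube_lt_top_of_levyWeight hlevy, fun s hs => ?_⟩
  obtain ⟨t, rfl⟩ : ∃ t : Fin n → ℝ≥0, s = fun j => -(t j : ℝ) :=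
    ⟨fun j => (-s j).toNNReal, by ext j; rw [Real.coe_toNNReal _ (by linarith [hs j]), neg_neg]⟩
  have ht : ∀ j, 0 < t j := fun j => by
    have := hs j
    simp only [neg_lt_zero] at this
    exact_mod_cast this
  obtain ⟨h1, h2⟩ := hrep t ht
  have h3 := congrArg ENNReal.toReal h2
  have hsum : 0 ≤ ∑ j, c j * t j := Finset.sum_nonneg fun j _ => mul_nonneg (hc j) (t j).2
  rw [← hlint, ENNReal.toReal_add ENNReal.ofReal_ne_top (hfin t ht),
    ENNReal.toReal_ofReal (by linarith), ENNReal.toReal_ofReal hsum,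
    ← integral_eq_lintegral_of_nonneg_ae (hnn1 t) (hmeas t)] at h3
  rw [hκ]
  have h4 : ∫ u, (Real.exp (∑ j, -(t j : ℝ) * u j) - 1) ∂κ =
      -∫ u, (1 - Real.exp (-∑ j, (t j : ℝ) * u j)) ∂κ := by
    rw [← integral_neg]
    simp
  rw [h4]
  simp only [mul_neg, Finset.sum_neg_distrib]
  linarith

/-! ### Kernel estimates, continuity and holomorphy of the extension. -/

theorem norm_exp_sub_one_le_two {w : ℂ} (hw : w.re ≤ 0) : ‖Complex.exp w - 1‖ ≤ 2 := by
  refine (norm_sub_le _ _).trans ?_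
  rw [Complex.norm_exp, norm_one]
  linarith [Real.exp_le_one_iff.2 hw]

/-- Mean value inequality from `0` to `w` in the closed left half-plane, where the derivative of
`exp` has norm at most `1`. -/
theorem norm_exp_sub_one_le_norm {w : ℂ} (hw : w.re ≤ 0) : ‖Complex.exp w - 1‖ ≤ ‖w‖ := by
  have := Convex.norm_image_sub_le_of_norm_deriv_le (f := Complex.exp) (C := 1)
    (s := {w : ℂ | w.re ≤ 0}) (x := 0) (y := w)
    (fun x _ => Complex.differentiableAt_exp)
    (fun x hx => by
      rw [Complex.deriv_exp, Complex.norm_exp]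
      exact Real.exp_le_one_iff.2 hx)
    (convex_halfSpace_re_le 0) (by simp) hw
  simpa using this

section Kernel

variable {n : ℕ}

theorem sum_mul_re (z : Fin n → ℂ) (u : Fin n → ℝ) :
    (∑ j, z j * (u j : ℂ)).re = ∑ j, (z j).re * u j := by
  simp

theorem sum_mul_im (z : Fin n → ℂ) (u : Fin n → ℝ) :
    (∑ j, z j * (u j : ℂ)).im = ∑ j, (z j).im * u j := by
  simp

theorem sum_mul_re_nonpos {z : Fin n → ℂ} {u : Fin n → ℝ} (hz : ∀ j, (z j).re ≤ 0)
    (hu : ∀ j, 0 ≤ u j) : (∑ j, z j * (u j : ℂ)).re ≤ 0 := by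
  rw [sum_mul_re]
  exact Finset.sum_nonpos fun j _ => mul_nonpos_of_nonpos_of_nonneg (hz j) (hu j)

theorem norm_bernsteinKernel_le {z : Fin n → ℂ} {u : Fin n → ℝ} (hz : ∀ j, (z j).re ≤ 0)
    (hu : ∀ j, 0 ≤ u j) : ‖bernsteinKernel z u‖ ≤ (2 + ‖z‖) * levyWeight u := by
  have hw := sum_mul_re_nonpos hz hu
  have hs : 0 ≤ ∑ j, u j := Finset.sum_nonneg fun j _ => hu j
  have hn := norm_nonneg z
  rcases le_total 1 (∑ j, u j) with h | h
  · rw [levyWeight, min_eq_left h]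
    exact (norm_exp_sub_one_le_two hw).trans (by linarith)
  · rw [levyWeight, min_eq_right h]
    refine (norm_exp_sub_one_le_norm hw).trans ?_
    have : ‖∑ j, z j * (u j : ℂ)‖ ≤ ‖z‖ * ∑ j, u j := by
      rw [Finset.mul_sum]
      refine norm_sum_le_of_le _ fun j _ => ?_
      rw [norm_mul, Complex.norm_real, Real.norm_of_nonneg (hu j)]
      exact mul_le_mul_of_nonneg_right (norm_le_pi_norm z j) (hu j)
    nlinarith

theorem continuous_bernsteinKernel_right (z : Fin n → ℂ) : Continuous (bernsteinKernel z) := by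
  unfold bernsteinKernel; fun_prop

theorem continuous_bernsteinKernel_left (u : Fin n → ℝ) :
    Continuous fun z => bernsteinKernel z u := by
  unfold bernsteinKernel; fun_prop

variable {μ : Measure (Fin n → ℝ)}

theorem ae_restrict_puncturedOrthant {p : (Fin n → ℝ) → Prop} (h : ∀ u ∈ puncturedOrthant n, p u) :
    ∀ᵐ u ∂μ.restrict (puncturedOrthant n), p u :=
  (ae_restrict_iff' measurableSet_puncturedOrthant).2 (ae_of_all _ h)

theorem integrableOn_bernsteinKernel (hμ : IntegrableOn levyWeight (puncturedOrthant n) μ)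
    {z : Fin n → ℂ} (hz : ∀ j, (z j).re ≤ 0) :
    IntegrableOn (bernsteinKernel z) (puncturedOrthant n) μ :=
  Integrable.mono' (hμ.const_mul (2 + ‖z‖))
    (continuous_bernsteinKernel_right z).aestronglyMeasurable
    (ae_restrict_puncturedOrthant fun _ hu => norm_bernsteinKernel_le hz hu.1)

theorem continuousOn_bernsteinExt (hμ : IntegrableOn levyWeight (puncturedOrthant n) μ)
    (c₀ : ℝ) (c₁ : Fin n → ℝ) :
    ContinuousOn (bernsteinExt c₀ c₁ μ) {z | ∀ j, (z j).re ≤ 0} := by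
  unfold bernsteinExt
  refine ContinuousOn.add (by fun_prop) fun z₀ hz₀ => ?_
  refine continuousWithinAt_of_dominated (bound := fun u => (2 + (‖z₀‖ + 1)) * levyWeight u)
    (Eventually.of_forall fun z => (continuous_bernsteinKernel_right z).aestronglyMeasurable)
    ?_ (hμ.const_mul _)
    (ae_of_all _ fun u => (continuous_bernsteinKernel_left u).continuousWithinAt)
  have h1 : ∀ᶠ z in 𝓝[{z | ∀ j, (z j).re ≤ 0}] z₀, ‖z‖ < ‖z₀‖ + 1 :=
    nhdsWithin_le_nhds (continuous_norm.continuousAt.eventually_lt continuousAt_const (by simp))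
  filter_upwards [h1, self_mem_nhdsWithin] with z hz hzD
  refine ae_restrict_puncturedOrthant fun u hu => (norm_bernsteinKernel_le hzD hu.1).trans ?_
  exact mul_le_mul_of_nonneg_right (by linarith) (levyWeight_nonneg hu.1)

/-- Dominates the derivative of the kernel. For large `u` the exponential absorbs the linear factor,
at the price of `η⁻¹`; for small `u` it is bounded by `1`. -/
theorem mul_exp_neg_le_levyWeight {u : Fin n → ℝ} (hu : ∀ j, 0 ≤ u j) (j : Fin n) {η : ℝ}
    (hη : 0 < η) : u j * Real.exp (-(η * u j)) ≤ (1 + η⁻¹) * levyWeight u := by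
  have hj := hu j
  have hη' : 0 < η⁻¹ := inv_pos.2 hη
  rcases le_total 1 (∑ j, u j) with h | h
  · rw [levyWeight, min_eq_left h]
    have h1 : u j * Real.exp (-(η * u j)) ≤ η⁻¹ := by
      rw [Real.exp_neg, ← div_eq_mul_inv, div_le_iff₀ (Real.exp_pos _)]
      have := Real.add_one_le_exp (η * u j)
      calc u j = η⁻¹ * (η * u j) := by field_simp
        _ ≤ _ := mul_le_mul_of_nonneg_left (by linarith) hη'.le
    linarith
  · rw [levyWeight, min_eq_right h]
    have h1 : Real.exp (-(η * u j)) ≤ 1 := Real.exp_le_one_iff.2 (by simp; positivity)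
    have h2 := le_sum_of_nonneg hu j
    nlinarith [mul_le_mul_of_nonneg_left h1 hj]

theorem closure_leftDomain_subset (n : ℕ) :
    closure (leftDomain n) ⊆ {z | ∀ j, (z j).re ≤ 0} := by
  refine closure_minimal (fun z hz j => (hz j).le) ?_
  have : {z : Fin n → ℂ | ∀ j, (z j).re ≤ 0} = ⋂ j, {z | (z j).re ≤ 0} := by ext; simp
  rw [this]
  exact isClosed_iInter fun j =>
    isClosed_le (Complex.continuous_re.comp (continuous_apply j)) continuous_const

/-- The linear form `z ↦ u · z`. -/
noncomputable def dotCLM (u : Fin n → ℝ) : (Fin n → ℂ) →L[ℂ] ℂ :=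
  ∑ j, (u j : ℂ) • ContinuousLinearMap.proj j

theorem dotCLM_apply (u : Fin n → ℝ) (z : Fin n → ℂ) : dotCLM u z = ∑ j, z j * (u j : ℂ) := by
  simp [dotCLM, mul_comm]

theorem norm_dotCLM_le {u : Fin n → ℝ} (hu : ∀ j, 0 ≤ u j) : ‖dotCLM u‖ ≤ ∑ j, u j := by
  refine ContinuousLinearMap.opNorm_le_bound _ (Finset.sum_nonneg fun j _ => hu j) fun z => ?_
  rw [dotCLM_apply, Finset.sum_mul]
  refine norm_sum_le_of_le _ fun j _ => ?_
  rw [norm_mul, Complex.norm_real, Real.norm_of_nonneg (hu j), mul_comm]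
  exact mul_le_mul_of_nonneg_left (norm_le_pi_norm z j) (hu j)

theorem continuous_dotCLM : Continuous (dotCLM (n := n)) := by
  unfold dotCLM; fun_prop

theorem hasFDerivAt_bernsteinKernel (u : Fin n → ℝ) (z : Fin n → ℂ) :
    HasFDerivAt (fun z => bernsteinKernel z u)
      (Complex.exp (∑ j, z j * (u j : ℂ)) • dotCLM u) z := by
  have := ((dotCLM u).hasFDerivAt (x := z)).cexp.sub_const (1 : ℂ)
  simpa only [bernsteinKernel, dotCLM_apply] using this

theorem differentiableOn_bernsteinExt (hμ : IntegrableOn levyWeight (puncturedOrthant n) μ)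
    (c₀ : ℝ) (c₁ : Fin n → ℝ) :
    DifferentiableOn ℂ (bernsteinExt c₀ c₁ μ) (leftDomain n) := by
  unfold bernsteinExt
  refine DifferentiableOn.add (by fun_prop) fun z₀ hz₀ => ?_
  -- Half the distance from `(z₀ j).re` to `0`, so that `(z j).re < -η j` holds on a whole
  -- neighbourhood of `z₀` and the domination there is uniform.
  let η : Fin n → ℝ := fun j => -(z₀ j).re / 2
  have hη : ∀ j, 0 < η j := fun j => by have := hz₀ j; simp only [η]; linarith
  let s : Set (Fin n → ℂ) := ⋂ j, {z | (z j).re < -η j}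
  have hs : s ∈ 𝓝 z₀ := by
    refine (isOpen_iInter_of_finite fun j => isOpen_lt
      (Complex.continuous_re.comp (continuous_apply j)) continuous_const).mem_nhds ?_
    refine mem_iInter.2 fun j => ?_
    have := hz₀ j
    simp only [η, mem_ofPred_eq, Function.comp_apply]; linarith
  have hmeas : Continuous fun u : Fin n → ℝ =>
      Complex.exp (∑ j, z₀ j * (u j : ℂ)) • dotCLM u := by
    have : Continuous fun u : Fin n → ℝ => Complex.exp (∑ j, z₀ j * (u j : ℂ)) := by fun_prop
    exact this.smul continuous_dotCLM
  have := hasFDerivAt_integral_of_dominated_of_fderiv_le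
    (μ := μ.restrict (puncturedOrthant n)) (F := fun z u => bernsteinKernel z u)
    (F' := fun z u => Complex.exp (∑ j, z j * (u j : ℂ)) • dotCLM u)
    (bound := fun u => ∑ j, (1 + (η j)⁻¹) * levyWeight u) hs
    (Eventually.of_forall fun z => (continuous_bernsteinKernel_right z).aestronglyMeasurable)
    (integrableOn_bernsteinKernel hμ fun j => (hz₀ j).le)
    (hmeas.aestronglyMeasurable)
    (ae_restrict_puncturedOrthant fun u hu z hz => ?_)
    (integrable_finsetSum _ fun j _ => hμ.const_mul _)
    (ae_of_all _ fun u z _ => hasFDerivAt_bernsteinKernel u z)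
  · exact this.differentiableAt.differentiableWithinAt
  · have hz' : ∀ j, (z j).re < -η j := fun j => mem_iInter.1 hz j
    rw [norm_smul, Complex.norm_exp, sum_mul_re]
    refine (mul_le_mul_of_nonneg_left (norm_dotCLM_le hu.1) (Real.exp_pos _).le).trans ?_
    rw [Finset.mul_sum]
    refine Finset.sum_le_sum fun j _ => le_trans ?_ (mul_exp_neg_le_levyWeight hu.1 j (hη j))
    rw [mul_comm]
    refine mul_le_mul_of_nonneg_left (Real.exp_le_exp.2 ?_) (hu.1 j)
    have hterm : ∀ i, (z i).re * u i ≤ 0 := fun i =>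
      mul_nonpos_of_nonpos_of_nonneg (by linarith [hz' i, hη i]) (hu.1 i)
    calc ∑ i, (z i).re * u i ≤ (z j).re * u j := by
          rw [← Finset.add_sum_erase _ _ (Finset.mem_univ j)]
          linarith [Finset.sum_nonpos (s := Finset.univ.erase j) fun i _ => hterm i]
      _ ≤ -η j * u j := mul_le_mul_of_nonneg_right (hz' j).le (hu.1 j)
      _ = -(η j * u j) := by ring

theorem bernsteinKernel_re (z : Fin n → ℂ) (u : Fin n → ℝ) :
    (bernsteinKernel z u).re =
      Real.exp (∑ j, (z j).re * u j) * Real.cos (∑ j, (z j).im * u j) - 1 := by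
  rw [bernsteinKernel, Complex.sub_re, Complex.exp_re, sum_mul_re, sum_mul_im, Complex.one_re]

theorem bernsteinKernel_re_le (z : Fin n → ℂ) (u : Fin n → ℝ) :
    (bernsteinKernel z u).re ≤ Real.exp (∑ j, (z j).re * u j) - 1 := by
  rw [bernsteinKernel_re]
  exact sub_le_sub_right (mul_le_of_le_one_right (Real.exp_pos _).le (Real.cos_le_one _)) 1

theorem bernsteinKernel_im (z : Fin n → ℂ) (u : Fin n → ℝ) :
    (bernsteinKernel z u).im =
      Real.exp (∑ j, (z j).re * u j) * Real.sin (∑ j, (z j).im * u j) := by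
  rw [bernsteinKernel, Complex.sub_im, Complex.exp_im, sum_mul_re, sum_mul_im, Complex.one_im,
    sub_zero]

theorem bernsteinKernel_ofReal (s u : Fin n → ℝ) :
    bernsteinKernel (fun j => (s j : ℂ)) u = ((Real.exp (∑ j, s j * u j) - 1 : ℝ) : ℂ) := by
  simp [bernsteinKernel]

theorem bernsteinExt_ofReal (c₀ : ℝ) (c₁ s : Fin n → ℝ) :
    bernsteinExt c₀ c₁ μ (fun j => (s j : ℂ)) = ((c₀ + ∑ j, c₁ j * s j
      + ∫ u in puncturedOrthant n, (Real.exp (∑ j, s j * u j) - 1) ∂μ : ℝ) : ℂ) := by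
  simp only [bernsteinExt, bernsteinKernel_ofReal]
  rw [integral_complex_ofReal]
  push_cast
  rfl

theorem bernsteinExt_re (hμ : IntegrableOn levyWeight (puncturedOrthant n) μ)
    (c₀ : ℝ) (c₁ : Fin n → ℝ) {z : Fin n → ℂ} (hz : ∀ j, (z j).re ≤ 0) :
    (bernsteinExt c₀ c₁ μ z).re = c₀ + ∑ j, c₁ j * (z j).re +
      ∫ u in puncturedOrthant n, (bernsteinKernel z u).re ∂μ := by
  have := Complex.reCLM.integral_comp_comm (integrableOn_bernsteinKernel hμ hz)
  simp only [Complex.reCLM_apply] at this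
  simp [bernsteinExt, this]

theorem bernsteinExt_im (hμ : IntegrableOn levyWeight (puncturedOrthant n) μ)
    (c₀ : ℝ) (c₁ : Fin n → ℝ) {z : Fin n → ℂ} (hz : ∀ j, (z j).re ≤ 0) :
    (bernsteinExt c₀ c₁ μ z).im = ∑ j, c₁ j * (z j).im +
      ∫ u in puncturedOrthant n, (bernsteinKernel z u).im ∂μ := by
  have := Complex.imCLM.integral_comp_comm (integrableOn_bernsteinKernel hμ hz)
  simp only [Complex.imCLM_apply] at this
  simp [bernsteinExt, this]

/-- A half-plane containing the negative real axis which contains all `z j` and all values of the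
kernel contains the value of `bernsteinExt`. -/
theorem bernsteinExt_mem_halfPlane (hμ : IntegrableOn levyWeight (puncturedOrthant n) μ)
    {c₀ : ℝ} {c₁ : Fin n → ℝ} (hc₀ : c₀ ≤ 0) (hc₁ : ∀ j, 0 ≤ c₁ j) {z : Fin n → ℂ}
    (hz : ∀ j, (z j).re ≤ 0) {p q : ℝ} (hp : 0 ≤ p)
    (hpz : ∀ j, p * (z j).re + q * (z j).im ≤ 0)
    (hk : ∀ u ∈ puncturedOrthant n,
      p * (bernsteinKernel z u).re + q * (bernsteinKernel z u).im ≤ 0) :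
    p * (bernsteinExt c₀ c₁ μ z).re + q * (bernsteinExt c₀ c₁ μ z).im ≤ 0 := by
  have hint := integrableOn_bernsteinKernel hμ hz
  have h1 : ∫ u in puncturedOrthant n,
      (p * (bernsteinKernel z u).re + q * (bernsteinKernel z u).im) ∂μ ≤ 0 :=
    integral_nonpos_of_ae (ae_restrict_puncturedOrthant hk)
  have hadd := integral_add (hint.re.const_mul p) (hint.im.const_mul q)
  simp only [RCLike.re_to_complex, RCLike.im_to_complex] at hadd
  rw [hadd, integral_const_mul, integral_const_mul] at h1
  have h2 : ∑ j, c₁ j * (p * (z j).re + q * (z j).im) ≤ 0 :=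
    Finset.sum_nonpos fun j _ => mul_nonpos_of_nonneg_of_nonpos (hc₁ j) (hpz j)
  have h3 : ∑ j, c₁ j * (p * (z j).re + q * (z j).im) =
      p * ∑ j, c₁ j * (z j).re + q * ∑ j, c₁ j * (z j).im := by
    rw [Finset.mul_sum, Finset.mul_sum, ← Finset.sum_add_distrib]
    exact Finset.sum_congr rfl fun j _ => by ring
  rw [bernsteinExt_re hμ c₀ c₁ hz, bernsteinExt_im hμ c₀ c₁ hz]
  have h4 : p * c₀ ≤ 0 := mul_nonpos_of_nonneg_of_nonpos hp hc₀
  rw [h3] at h2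
  linarith

end Kernel

/-! ### Sectors are preserved. -/

/-- If `β` is the angle from the negative real axis, the sector is `|β| ≤ π/2 - θ/2`, that is, `cos
|β| ≥ 0` and `cos (|β| + θ/2) ≥ 0`. The condition on the real part matters at `θ = π`, where the
other inequality only says `ζ.im = 0`. -/
theorem mem_closedSector_iff {θ : ℝ} (hθ : θ ∈ Icc (0 : ℝ) Real.pi) (ζ : ℂ) :
    ζ ∈ closedSector θ ↔
      ζ.re ≤ 0 ∧ Real.sin (θ / 2) * |ζ.im| ≤ -(Real.cos (θ / 2) * ζ.re) := by
  obtain ⟨hθ0, hθπ⟩ := hθ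
  have hpi := Real.pi_pos
  constructor
  · rintro ⟨r, hr, φ, ⟨hφ1, hφ2⟩, rfl⟩
    have hβ : |φ - Real.pi| ≤ Real.pi / 2 - θ / 2 := by
      rw [abs_le]; constructor <;> linarith
    have hre : ((r : ℂ) * Complex.exp ((φ : ℂ) * Complex.I)).re =
        -(r * Real.cos |φ - Real.pi|) := by
      rw [Complex.re_ofReal_mul, Complex.exp_ofReal_mul_I_re, Real.cos_abs, Real.cos_sub_pi]
      ring
    have him : |((r : ℂ) * Complex.exp ((φ : ℂ) * Complex.I)).im| =
        r * Real.sin |φ - Real.pi| := by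
      have : Real.sin |φ - Real.pi| = |Real.sin (φ - Real.pi)| :=
        (Real.abs_sin_eq_sin_abs_of_abs_le_pi (by linarith)).symm
      rw [Complex.im_ofReal_mul, Complex.exp_ofReal_mul_I_im, abs_mul, abs_of_nonneg hr, this,
        Real.sin_sub_pi, abs_neg]
    have h0 := abs_nonneg (φ - Real.pi)
    rw [hre, him]
    have hc : 0 ≤ Real.cos |φ - Real.pi| :=
      Real.cos_nonneg_of_neg_pi_div_two_le_of_le (by linarith) (by linarith)
    have hc' : 0 ≤ Real.cos (|φ - Real.pi| + θ / 2) :=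
      Real.cos_nonneg_of_neg_pi_div_two_le_of_le (by linarith) (by linarith)
    rw [Real.cos_add] at hc'
    refine ⟨by simpa using mul_nonneg hr hc, ?_⟩
    nlinarith [mul_nonneg hr hc']
  · rintro ⟨hre, him⟩
    rcases eq_or_ne ζ 0 with rfl | hζ
    · exact ⟨0, le_rfl, Real.pi / 2 + θ / 2, ⟨le_rfl, by linarith⟩, by simp⟩
    have hn : 0 < ‖ζ‖ := norm_pos_iff.2 hζ
    set β := Complex.arg (-ζ) with hβ
    have hpolar : -ζ = ‖ζ‖ * Complex.exp (β * Complex.I) := by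
      rw [← norm_neg, hβ, Complex.norm_mul_exp_arg_mul_I]
    have hre' : ζ.re = -(‖ζ‖ * Real.cos |β|) := by
      have := congrArg Complex.re hpolar
      rw [Complex.re_ofReal_mul, Complex.exp_ofReal_mul_I_re, Complex.neg_re] at this
      rw [Real.cos_abs]; linarith
    have hβπ : |β| ≤ Real.pi := Complex.abs_arg_le_pi _
    have him' : |ζ.im| = ‖ζ‖ * Real.sin |β| := by
      have := congrArg Complex.im hpolar
      rw [Complex.im_ofReal_mul, Complex.exp_ofReal_mul_I_im, Complex.neg_im] at this
      rw [← Real.abs_sin_eq_sin_abs_of_abs_le_pi hβπ, ← abs_neg, this, abs_mul,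
        abs_of_pos hn]
    have hc : 0 ≤ Real.cos |β| := by
      rw [hre'] at hre
      by_contra! h
      nlinarith
    have hβ2 : |β| ≤ Real.pi / 2 := by
      by_contra! h
      exact absurd (Real.cos_neg_of_pi_div_two_lt_of_lt h (by linarith)) (not_lt.2 hc)
    have hc' : 0 ≤ Real.cos (|β| + θ / 2) := by
      rw [hre', him'] at him
      rw [Real.cos_add]
      by_contra! h
      nlinarith
    have hβ3 : |β| + θ / 2 ≤ Real.pi / 2 := by
      by_contra! h
      exact absurd (Real.cos_neg_of_pi_div_two_lt_of_lt h (by linarith)) (not_lt.2 hc')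
    obtain ⟨h1, h2⟩ := abs_le.1 (show |β| ≤ Real.pi / 2 - θ / 2 by linarith)
    refine ⟨‖ζ‖, hn.le, Real.pi + β, ⟨by linarith, by linarith⟩, ?_⟩
    push_cast
    rw [add_mul, Complex.exp_add, Complex.exp_pi_mul_I, neg_one_mul, mul_neg, ← hpolar, neg_neg]

/-- The inequality behind the fact that `w ↦ e^w - 1` maps each sector `S_θ` into itself. -/
theorem sin_mul_abs_exp_mul_sin_le {c s a b : ℝ} (hc : 0 ≤ c) (hs : 0 ≤ s)
    (h : s * |b| ≤ -(c * a)) :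
    s * |Real.exp a * Real.sin b| ≤ -(c * (Real.exp a * Real.cos b - 1)) := by
  -- The chain is `s |sin b| + c cos b ≤ s |b| + c ≤ c (1 - a) ≤ c e^{-a}`; multiplication by `e^a`
  -- finishes.
  have h1 : c * (1 - a) ≤ c * Real.exp (-a) :=
    mul_le_mul_of_nonneg_left (by linarith [Real.add_one_le_exp (-a)]) hc
  have h2 : s * |Real.sin b| ≤ s * |b| := mul_le_mul_of_nonneg_left Real.abs_sin_le_abs hs
  have h3 : c * Real.cos b ≤ c * 1 := mul_le_mul_of_nonneg_left (Real.cos_le_one b) hc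
  have h4 : Real.exp a * (s * |Real.sin b| + c * Real.cos b) ≤
      Real.exp a * (c * Real.exp (-a)) :=
    mul_le_mul_of_nonneg_left (by linarith) (Real.exp_pos a).le
  have h5 : Real.exp a * (c * Real.exp (-a)) = c := by
    rw [mul_left_comm, ← Real.exp_add, add_neg_cancel, Real.exp_zero, mul_one]
  rw [abs_mul, abs_of_pos (Real.exp_pos a)]
  linarith

/-- The sector is cut out by the half-planes with `(p, q)` equal to `(1, 0)` and `(cos (θ/2), ± sin
(θ/2))`. Each contains all `z j` and all kernel values. -/
theorem mapsTo_bernsteinExt_closedSector {n : ℕ} {μ : Measure (Fin n → ℝ)}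
    (hμ : IntegrableOn levyWeight (puncturedOrthant n) μ) {c₀ : ℝ} {c₁ : Fin n → ℝ}
    (hc₀ : c₀ ≤ 0) (hc₁ : ∀ j, 0 ≤ c₁ j) {θ : ℝ} (hθ : θ ∈ Icc (0 : ℝ) Real.pi) :
    MapsTo (bernsteinExt c₀ c₁ μ) {z | ∀ j, z j ∈ closedSector θ} (closedSector θ) := by
  intro z hz
  have hpi := Real.pi_pos
  have hc : 0 ≤ Real.cos (θ / 2) :=
    Real.cos_nonneg_of_neg_pi_div_two_le_of_le (by linarith [hθ.1]) (by linarith [hθ.2])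
  have hs : 0 ≤ Real.sin (θ / 2) :=
    Real.sin_nonneg_of_nonneg_of_le_pi (by linarith [hθ.1]) (by linarith [hθ.2])
  have hz1 : ∀ j, (z j).re ≤ 0 := fun j => ((mem_closedSector_iff hθ _).1 (hz j)).1
  have hz2 := fun j => ((mem_closedSector_iff hθ _).1 (hz j)).2
  have hk : ∀ u ∈ puncturedOrthant n, Real.sin (θ / 2) * |(bernsteinKernel z u).im| ≤
      -(Real.cos (θ / 2) * (bernsteinKernel z u).re) := by
    intro u hu
    rw [bernsteinKernel_re, bernsteinKernel_im]
    refine sin_mul_abs_exp_mul_sin_le hc hs ?_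
    calc Real.sin (θ / 2) * |∑ j, (z j).im * u j|
        ≤ Real.sin (θ / 2) * ∑ j, |(z j).im| * u j := by
          refine mul_le_mul_of_nonneg_left ((Finset.abs_sum_le_sum_abs _ _).trans_eq ?_) hs
          exact Finset.sum_congr rfl fun j _ => by rw [abs_mul, abs_of_nonneg (hu.1 j)]
      _ ≤ ∑ j, -(Real.cos (θ / 2) * (z j).re) * u j := by
          rw [Finset.mul_sum]
          refine Finset.sum_le_sum fun j _ => ?_
          rw [← mul_assoc]
          exact mul_le_mul_of_nonneg_right (hz2 j) (hu.1 j)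
      _ = -(Real.cos (θ / 2) * ∑ j, (z j).re * u j) := by
          rw [Finset.mul_sum, ← Finset.sum_neg_distrib]
          exact Finset.sum_congr rfl fun j _ => by ring
  have habs : ∀ ζ : ℂ, Real.sin (θ / 2) * |ζ.im| ≤ -(Real.cos (θ / 2) * ζ.re) ↔
      Real.cos (θ / 2) * ζ.re + Real.sin (θ / 2) * ζ.im ≤ 0 ∧
      Real.cos (θ / 2) * ζ.re + -Real.sin (θ / 2) * ζ.im ≤ 0 := by
    intro ζ
    rw [← abs_of_nonneg hs, ← abs_mul, abs_of_nonneg hs, abs_le]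
    constructor
    · rintro ⟨h1, h2⟩; constructor <;> linarith
    · rintro ⟨h1, h2⟩; constructor <;> linarith
  rw [mem_closedSector_iff hθ, habs]
  refine ⟨?_, ?_, ?_⟩
  · have := bernsteinExt_mem_halfPlane hμ hc₀ hc₁ hz1 (p := 1) (q := 0) zero_le_one
      (by simpa using hz1) fun u hu => by
        rw [one_mul, zero_mul, add_zero]
        refine (bernsteinKernel_re_le z u).trans (sub_nonpos.2 (Real.exp_le_one_iff.2 ?_))
        exact Finset.sum_nonpos fun j _ => mul_nonpos_of_nonpos_of_nonneg (hz1 j) (hu.1 j)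
    simpa using this
  · exact bernsteinExt_mem_halfPlane hμ hc₀ hc₁ hz1 hc (fun j => ((habs _).1 (hz2 j)).1)
      fun u hu => ((habs _).1 (hk u hu)).1
  · exact bernsteinExt_mem_halfPlane hμ hc₀ hc₁ hz1 hc (fun j => ((habs _).1 (hz2 j)).2)
      fun u hu => ((habs _).1 (hk u hu)).2

/-! ### Strict negativity and the conclusion. -/

theorem IsBernsteinRep.integrableOn_levyWeight {n : ℕ} {ψ : (Fin n → ℝ) → ℝ} {c₀ : ℝ}
    {c₁ : Fin n → ℝ} {μ : Measure (Fin n → ℝ)} (h : IsBernsteinRep ψ c₀ c₁ μ) :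
    IntegrableOn levyWeight (puncturedOrthant n) μ :=
  _root_.integrableOn_levyWeight h.integrableOn_coord h.measure_compl_lt_top

theorem integrableOn_exp_sub_one {n : ℕ} {μ : Measure (Fin n → ℝ)}
    (hμ : IntegrableOn levyWeight (puncturedOrthant n) μ) {s : Fin n → ℝ}
    (hs : s ∈ negOrthant n) :
    IntegrableOn (fun u => Real.exp (∑ j, s j * u j) - 1) (puncturedOrthant n) μ := by
  have := (integrableOn_bernsteinKernel hμ (z := fun j => (s j : ℂ)) fun j => (hs j).le).re
  simp only [bernsteinKernel_ofReal, RCLike.re_to_complex, Complex.ofReal_re] at this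
  exact this

theorem exp_sum_mul_lt_one {n : ℕ} {s u : Fin n → ℝ} (hs : s ∈ negOrthant n)
    (hu : u ∈ puncturedOrthant n) : Real.exp (∑ j, s j * u j) < 1 := by
  rw [Real.exp_lt_one_iff]
  obtain ⟨j, hj⟩ := Function.ne_iff.1 hu.2
  exact Finset.sum_neg' (fun i _ => mul_nonpos_of_nonpos_of_nonneg (hs i).le (hu.1 i))
    ⟨j, Finset.mem_univ j, mul_neg_of_neg_of_pos (hs j) ((hu.1 j).lt_of_ne' hj)⟩

/-- All three terms of the representation are nonpositive. If `ψ` vanishes at one point of the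
orthant, each term does, which forces `c₀ = 0`, `c₁ = 0` and no mass on the punctured orthant, hence
`ψ = 0` everywhere there. -/
theorem IsBernsteinRep.neg {n : ℕ} {ψ : (Fin n → ℝ) → ℝ} {c₀ : ℝ}
    {c₁ : Fin n → ℝ} {μ : Measure (Fin n → ℝ)} (h : IsBernsteinRep ψ c₀ c₁ μ)
    (hne : ∃ s ∈ negOrthant n, ψ s ≠ 0) {s : Fin n → ℝ} (hs : s ∈ negOrthant n) : ψ s < 0 := by
  have hint := integrableOn_exp_sub_one h.integrableOn_levyWeight hs
  have hnp : ∀ᵐ u ∂μ.restrict (puncturedOrthant n),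
      0 ≤ -(Real.exp (∑ j, s j * u j) - 1) :=
    ae_restrict_puncturedOrthant fun u hu => by linarith [exp_sum_mul_lt_one hs hu]
  have h1 : 0 ≤ ∫ u in puncturedOrthant n, -(Real.exp (∑ j, s j * u j) - 1) ∂μ :=
    integral_nonneg_of_ae hnp
  have hterm : ∀ j, c₁ j * s j ≤ 0 := fun j =>
    mul_nonpos_of_nonneg_of_nonpos (h.coeff_nonneg j) (hs j).le
  have h2 : ∑ j, c₁ j * s j ≤ 0 := Finset.sum_nonpos fun j _ => hterm j
  have h3 := h.const_nonpos
  have h4 := h.eq_integral s hs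
  have h5 := integral_neg (μ := μ.restrict (puncturedOrthant n))
    fun u => Real.exp (∑ j, s j * u j) - 1
  by_contra! hψ
  have hc0 : c₀ = 0 := by linarith
  have hsum : ∑ j, c₁ j * s j = 0 := by linarith
  have hI : ∫ u in puncturedOrthant n, -(Real.exp (∑ j, s j * u j) - 1) ∂μ = 0 := by linarith
  have hc1 : ∀ j, c₁ j = 0 := fun j => by
    have := (Finset.sum_eq_zero_iff_of_nonpos fun j _ => hterm j).1 hsum j (Finset.mem_univ j)
    exact (mul_eq_zero.1 this).resolve_right (hs j).ne
  have hae := (integral_eq_zero_iff_of_nonneg_ae hnp hint.neg).1 hI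
  have hfalse : ∀ᵐ _ ∂μ.restrict (puncturedOrthant n), False := by
    filter_upwards [hae, ae_restrict_puncturedOrthant fun u hu => exp_sum_mul_lt_one hs hu]
      with u hu1 hu2
    simp only [Pi.zero_apply] at hu1
    linarith
  have hμ0 : μ.restrict (puncturedOrthant n) = 0 := by
    rwa [eventually_false_iff_eq_bot, ae_eq_bot] at hfalse
  obtain ⟨s', hs', hne⟩ := hne
  refine hne ?_
  rw [h.eq_integral s' hs', hμ0, hc0]
  simp [hc1]

theorem theorem2 (n : ℕ) (hn : 0 < n) (ψ : (Fin n → ℝ) → ℝ) (hψ : IsNegBernstein ψ)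
    (hne : ∃ s ∈ negOrthant n, ψ s ≠ 0) :
    -- the integral representation through which `ψ` is extended exists
    (∃ (c₀ : ℝ) (c₁ : Fin n → ℝ) (μ : Measure (Fin n → ℝ)), IsBernsteinRep ψ c₀ c₁ μ) ∧
    -- the extension given by any such representation
    ∀ (c₀ : ℝ) (c₁ : Fin n → ℝ) (μ : Measure (Fin n → ℝ)), IsBernsteinRep ψ c₀ c₁ μ →
      -- it is well defined on the closure of the domain, holomorphic, continuous, extends `ψ`
      (∀ z ∈ closure (leftDomain n), IntegrableOn (bernsteinKernel z) (puncturedOrthant n) μ) ∧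
      DifferentiableOn ℂ (bernsteinExt c₀ c₁ μ) (leftDomain n) ∧
      ContinuousOn (bernsteinExt c₀ c₁ μ) (closure (leftDomain n)) ∧
      (∀ s ∈ negOrthant n, bernsteinExt c₀ c₁ μ (fun j => (s j : ℂ)) = (ψ s : ℂ)) ∧
      -- it maps `{Re z < 0}` into the open left half-plane
      MapsTo (bernsteinExt c₀ c₁ μ) (leftDomain n) {ζ : ℂ | ζ.re < 0} ∧
      -- it maps the cone `S_θⁿ` into the closed sector `S_θ`
      ∀ θ ∈ Icc (0 : ℝ) Real.pi,
        MapsTo (bernsteinExt c₀ c₁ μ) {z | ∀ j, z j ∈ closedSector θ} (closedSector θ) := by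
  refine ⟨hψ.exists_isBernsteinRep, fun c₀ c₁ μ h => ?_⟩
  have hμ := h.integrableOn_levyWeight
  refine ⟨fun z hz => integrableOn_bernsteinKernel hμ (closure_leftDomain_subset n hz),
    differentiableOn_bernsteinExt hμ c₀ c₁,
    (continuousOn_bernsteinExt hμ c₀ c₁).mono (closure_leftDomain_subset n),
    fun s hs => by rw [bernsteinExt_ofReal, h.eq_integral s hs], fun z hz => ?_,
    fun θ hθ => mapsTo_bernsteinExt_closedSector hμ h.const_nonpos h.coeff_nonneg hθ⟩
  have hs : (fun j => (z j).re) ∈ negOrthant n := hz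
  have hz' : ∀ j, (z j).re ≤ 0 := fun j => (hz j).le
  refine lt_of_le_of_lt ?_ (h.neg hne hs)
  rw [bernsteinExt_re hμ c₀ c₁ hz', h.eq_integral _ hs]
  -- Taking real parts under the integral and using `cos ≤ 1` gives `Re ψ(z) ≤ ψ(Re z)`.
  have := integral_mono (integrableOn_bernsteinKernel hμ hz').re
    (integrableOn_exp_sub_one hμ hs) fun u => bernsteinKernel_re_le z u
  simp only [RCLike.re_to_complex] at this
  linarith
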